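/- **Setting.** All logarithms are to base $2$, $\log 0=-\infty$. For a channel with finite input alphabet $\mathcal M$, output space $\mathcal Z$ and uniform input $M$, a (measurable) set $\mathcal T\subset\mathcal M\times\mathcal Z$ is $(1-\epsilon)$-typical if $\mathbb P[(M,Z)\in\mathcal T\mid M=m]\ge 1-\epsilon$ for all $m\in\mathcal M$. Put $$I_\infty^{\mathcal T}(M;Z)=\log|\mathcal M|+\log \mathbb E_Z\Big[\max_{m}\mathbb P(M=m\mid Z)\,\mathbf 1((m,Z)\in\mathcal T)\Big],\qquad I_\infty^{\epsilon}(M;Z)=\inf_{\mathcal T\ (1-\epsilon)\text{-typical}} I_\infty^{\mathcal T}(M;Z).$$ On the real fast-fading wiretap channel without CSIT the eavesdropper observes $(Z^n,H_T^n,H_E^n)$ with $Z_i=H_{E,i}X_i+U_{E,i}$, where $H_{T,i}$, $H_{E,i}$, $U_{E,i}$ $(1\le i\le n)$ are independent of each other and of $X^n$, the $H_{T,i}\ge0$ are i.i.d., the $H_{E,i}\ge 0$ are i.i.d. copies of $H_E$ with $\mathbb E[H_E^2]<\infty$, and $U_{E,i}\sim\mathcal N(0,\sigma_E^2)$, $\sigma_E>0$.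 The input $X^n$ is uniform on a nonempty finite codebook $\mathcal C_n\subset\mathbb R^n$ all of whose elements satisfy $\frac1n\|x^n\|^2\le P$, where $P>0$. Let $\mathrm{SNR}=P/\sigma_E^2$ and $C_E=\frac12\mathbb E[\log(1+H_E^2\,\mathrm{SNR})]$. For $\delta,\delta',\delta''>0$ let $\mathcal T_n=\mathcal T_n(\delta,\delta',\delta'')$ be the set of all $(x^n,h_E^n,z^n)\in\mathcal C_n\times\mathbb R_{\ge0}^n\times\mathbb R^n$ with $$\frac1n\sum_{i}\frac{z_i^2}{\sigma_E^2+h_{E,i}^2P}-1\le\delta,\qquad \sum_i(z_i-x_ih_{E,i})^2\ge n\sigma_E^2(1-\delta'),\qquad \Big|\frac1n\sum_i\log(1+h_{E,i}^2\mathrm{SNR})-\mathbb E[\log(1+H_E^2\mathrm{SNR})]\Big|\le\delta'',$$ and for $K>0$ let $$\epsilon_n=\epsilon_n(K,\delta,\delta',\delta'')=2e^{-n\delta^2/(4K)}+e^{-n\delta'^2/4}+2e^{-n\delta''^2/(4K)}.$$ For $\gamma>0$ say that $K$ is a $\gamma$-tail bound for $\mathcal C_n$ if $2(\mathbb E V^4)^{1/2}\,\mathbb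 E[e^{\gamma|V|}]\le K$ for $V=\log(1+H_E^2\mathrm{SNR})$ and for each $V=(H_Ex_i+U_E)^2/(\sigma_E^2+H_E^2P)$, where $x_i$ is any coordinate of any codeword of $\mathcal C_n$, and $U_E\sim\mathcal N(0,\sigma_E^2)$ is independent of $H_E$. **Theorem.** 1. For every $\gamma\in(0,\frac12)$ there is $\delta_0>0$, depending only on $\gamma$ and the channel, such that for every $n\ge1$, every codebook $\mathcal C_n$ as above, every $\gamma$-tail bound $K$ for $\mathcal C_n$, all $\delta,\delta''\in(0,\delta_0]$ and all $\delta'>0$, the set $\mathbb R_{\ge0}^n\times\mathcal T_n$ of tuples $(h_T^n,x^n,h_E^n,z^n)$ is $(1-\epsilon_n)$-typical. 2. For every sequence of codebooks $\mathcal C_n$ as above and all positive sequences $\delta_n,\delta_n',\delta_n''\to0$, with $\mathcal T_n=\mathcal T_n(\delta_n,\delta'_n,\delta''_n)$ and, for any constant $K>0$, $\epsilon_n=\epsilon_n(K,\delta_n,\delta_n',\delta_n'')$, $$\limsup_{n\to\infty}\frac{1}{n}I_\infty^{\mathbb R_{\ge0}^n\times\mathcal T_n}(X^n;Z^n,H_T^n,H_E^n)\le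 C_E,\qquad \limsup_{n\to\infty}\frac{1}{n}I_\infty^{\epsilon_n}(X^n;Z^n,H_T^n,H_E^n)\le C_E .$$ 3. For every $\eta>0$ there is $c>0$, depending only on $\eta$ and the channel, such that for every sequence of codebooks $\mathcal C_n$ as above, $$\limsup_{n\to\infty}\frac{1}{n}I_\infty^{\exp(-cn)}(X^n;Z^n,H_T^n,H_E^n)\le C_E+\eta .$$ -/

import Mathlib

open MeasureTheory ProbabilityTheory Filter Topology
open scoped ENNReal NNReal

noncomputable section

namespace MaxInfo

/-! ### Smooth max-information of a uniform input

A channel with finite input alphabet `M` and output space `Z` is given by the conditional output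
laws `W m`, `m : M`; the input is uniform on `M`.  All logarithms have base `2`.  Values are
extended reals, so that `log 0 = -∞`. -/

/-- Base-2 logarithm on `[0, ∞]`. -/
def log2 (x : ℝ≥0∞) : EReal := ENNReal.log x / ((Real.log 2 : ℝ) : EReal)

variable {M Z : Type*} [Fintype M] [MeasurableSpace Z]

/-- The law of the output when the input is uniform. -/
def outputLaw (W : M → Measure Z) : Measure Z :=
  (Fintype.card M : ℝ≥0∞)⁻¹ • ∑ m, W m

/-- The conditional probability `ω(m | z)` of the input given the output: the density of the
measure `ℙ[input = m, output ∈ ·]` with respect to the law of the output. -/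
def postProb (W : M → Measure Z) (m : M) (z : Z) : ℝ≥0∞ :=
  ((Fintype.card M : ℝ≥0∞)⁻¹ • W m).rnDeriv (outputLaw W) z

/-- Conditional min-entropy restricted to `T`:
`H_∞^T = - log ∫ ω(z) max_m (ω(m | z) 1((m, z) ∈ T)) dz`. -/
def condMinEntropyOn (W : M → Measure Z) (T : Set (M × Z)) : EReal :=
  -log2 (∫⁻ z, ⨆ m : M, T.indicator (fun p => postProb W p.1 p.2) (m, z) ∂(outputLaw W))

/-- Max-information evaluated on `T`: `I_∞^T = log |M| - H_∞^T`. -/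
def maxInfoOn (W : M → Measure Z) (T : Set (M × Z)) : EReal :=
  log2 (Fintype.card M : ℝ≥0∞) - condMinEntropyOn W T

/-- `T` is a `(1 - ε)`-typical set: conditionally on every input `m`, the pair (input, output)
belongs to `T` with probability at least `1 - ε`. -/
structure IsTypical (W : M → Measure Z) (ε : ℝ) (T : Set (M × Z)) : Prop where
  measurableSet_fiber : ∀ m, MeasurableSet {z | (m, z) ∈ T}
  le_prob : ∀ m, 1 - ε ≤ (W m).real {z | (m, z) ∈ T}

/-- `ε`-smooth max-information: the infimum of `I_∞^T` over all `(1 - ε)`-typical sets `T`. -/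
def smoothMaxInfo (W : M → Measure Z) (ε : ℝ) : EReal :=
  ⨅ T : {T : Set (M × Z) // IsTypical W ε T}, maxInfoOn W T.1

end MaxInfo

namespace Fading

/-! ### The real fast fading channel to the eavesdropper, without CSIT

`P` is the power constraint, `σ ^ 2` the variance of the eavesdropper's noise, `lawT` and `lawE`
are the laws of the non-negative channel coefficients `H_T` and `H_E`. -/

/-- What the eavesdropper observes in `n` channel uses: `(Z^n, H_T^n, H_E^n)`. -/
abbrev Obs (n : ℕ) : Type := (Fin n → ℝ) × (Fin n → ℝ) × (Fin n → ℝ)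

/-- The law of `(Z^n, H_T^n, H_E^n)` when `x` is sent, where `Z_i = H_{E,i} x_i + U_{E,i}` and
the `H_{T,i}`, `H_{E,i}`, `U_{E,i}` are all independent with laws `lawT`, `lawE`, `N(0, σ²)`. -/
def obsLaw (σ : ℝ) (lawT lawE : Measure ℝ) {n : ℕ} (x : Fin n → ℝ) : Measure (Obs n) :=
  (((Measure.pi fun _ : Fin n => lawT).prod (Measure.pi fun _ : Fin n => lawE)).prod
    (Measure.pi fun _ : Fin n => gaussianReal 0 (Real.toNNReal (σ ^ 2)))).map
    fun q => (fun i => q.1.2 i * x i + q.2 i, q.1.1, q.1.2)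

/-- The channel from the codebook `C` to the eavesdropper's observations. -/
def eveChannel (σ : ℝ) (lawT lawE : Measure ℝ) {n : ℕ} (C : Finset (Fin n → ℝ)) :
    C → Measure (Obs n) :=
  fun x => obsLaw σ lawT lawE x.1

/-- Every codeword has average power at most `P`. -/
def PowerConstrained (P : ℝ) {n : ℕ} (C : Finset (Fin n → ℝ)) : Prop :=
  ∀ x ∈ C, (1 / (n : ℝ)) * ∑ i, x i ^ 2 ≤ P

/-- `E[log (1 + H_E² SNR)]`, where `SNR = P / σ²`. -/
def meanLogGain (P σ : ℝ) (lawE : Measure ℝ) : ℝ :=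
  ∫ h, Real.logb 2 (1 + h ^ 2 * (P / σ ^ 2)) ∂lawE

/-- The point-to-point capacity formula of the eavesdropper's channel. -/
def capE (P σ : ℝ) (lawE : Measure ℝ) : ℝ := (1 / 2) * meanLogGain P σ lawE

/-- Output power condition. -/
def powerOut (P σ δ : ℝ) (n : ℕ) : Set ((Fin n → ℝ) × (Fin n → ℝ)) :=
  {p | (∀ i, 0 ≤ p.1 i) ∧
    (1 / (n : ℝ)) * ∑ i, p.2 i ^ 2 / (σ ^ 2 + p.1 i ^ 2 * P) - 1 ≤ δ}

/-- Noise power condition, for a given codeword `x` and given coefficients `h`. -/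
def powerNoise (σ δ' : ℝ) {n : ℕ} (x h : Fin n → ℝ) : Set (Fin n → ℝ) :=
  {z | (n : ℝ) * σ ^ 2 * (1 - δ') ≤ ∑ i, (z i - x i * h i) ^ 2}

/-- Channel coefficient condition. -/
def powerErg (P σ : ℝ) (lawE : Measure ℝ) (δ'' : ℝ) (n : ℕ) : Set (Fin n → ℝ) :=
  {h | (∀ i, 0 ≤ h i) ∧
    |(1 / (n : ℝ)) * ∑ i, Real.logb 2 (1 + h i ^ 2 * (P / σ ^ 2)) - meanLogGain P σ lawE| ≤ δ''}

/-- The set `ℝ₊^n × T_n`: `h_T^n ∈ ℝ₊^n` is arbitrary and `(x^n, h_E^n, z^n) ∈ T_n`, that is, it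
satisfies the three conditions; written as a set of pairs
(codeword `x^n`, observation `(z^n, h_T^n, h_E^n)`). -/
def typicalSet (P σ : ℝ) (lawE : Measure ℝ) (δ δ' δ'' : ℝ) {n : ℕ} (C : Finset (Fin n → ℝ)) :
    Set (C × Obs n) :=
  {p | (∀ i, 0 ≤ p.2.2.1 i) ∧
    (p.2.2.2, p.2.1) ∈ powerOut P σ δ n ∧
    p.2.1 ∈ powerNoise σ δ' p.1.1 p.2.2.2 ∧
    p.2.2.2 ∈ powerErg P σ lawE δ'' n}

/-- The constant `2 (E[V⁴])^{1/2} E[e^{γ|V|}]` of a random variable `V`. -/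
def tailConst {Ω : Type*} [MeasurableSpace Ω] (μ : Measure Ω) (γ : ℝ) (V : Ω → ℝ) : ℝ :=
  2 * Real.sqrt (∫ w, V w ^ 4 ∂μ) * ∫ w, Real.exp (γ * |V w|) ∂μ

/-- `K` bounds the tail constants of the normalised output powers
`(H_E x_i + U_E)² / (σ² + H_E² P)` for all symbols `x_i` of all codewords, and the one of
`log (1 + H_E² SNR)`.  The least such `K` is the maximum `K*` of these constants. -/
def IsTailBound (P σ : ℝ) (lawE : Measure ℝ) (γ : ℝ) {n : ℕ} (C : Finset (Fin n → ℝ))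
    (K : ℝ) : Prop :=
  (∀ x ∈ C, ∀ i, tailConst (lawE.prod (gaussianReal 0 (Real.toNNReal (σ ^ 2)))) γ
      (fun q => (q.1 * x i + q.2) ^ 2 / (σ ^ 2 + q.1 ^ 2 * P)) ≤ K) ∧
    tailConst lawE γ (fun h => Real.logb 2 (1 + h ^ 2 * (P / σ ^ 2))) ≤ K

/-- `ε_n = 2 e^{-n c δ²} + e^{-n δ'² / 4} + 2 e^{-n c δ''²}` with `c = 1 / (4 K)`. -/
def eps (K : ℝ) (n : ℕ) (δ δ' δ'' : ℝ) : ℝ :=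
  2 * Real.exp (-((n : ℝ) * (1 / (4 * K)) * δ ^ 2)) + Real.exp (-((n : ℝ) / 4 * δ' ^ 2)) +
    2 * Real.exp (-((n : ℝ) * (1 / (4 * K)) * δ'' ^ 2))

end Fading

end

open MaxInfo Fading

/-! If the conditional output densities are dominated on `T` by a function `g`, then `I_∞^T ≤ log ∫
g`: the uniform prior contributes a factor `1/|M|` to the joint density, and this cancels `log |M|`.
The task is therefore to choose an auxiliary product density for the outputs given the fading, and
to bound the log-likelihood ratio against it on `T`.

On `T_n` the auxiliary density is Gaussian with variances `(1+δ)(σ²+h²P)`. The three defining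
conditions bound the three terms of the ratio: output power, noise power and log gain. The power
terms cancel up to `δ'` and `log(1+δ)`, and the gain leaves `n C_E` (`maxInfoOn_typicalSet_le`).
Typicality is a Chernoff bound. The mean normalised output power is `1 + κ(x²-P)` with `κ =
powerSlope`, so the power constraint brings its average over a codeword below `1`
(`isTypical_typicalSet`).

The smooth bounds cannot use `T_n`: a symbol may be as large as `√(nP)`, the tail constants may be
unbounded, and `K` is arbitrary. Another set is used, on which the total log-likelihood ratio
against the Gaussian density plus `ρ/(1+z²)` is small. The heavy tail makes the loss of a large
symbol grow like `log(1+x²)` instead of `x²`. A small-order exponential moment is then at most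
`exp(s(C_E log 2 + η + c(x²-P)))` for every `x` (`exists_lintegral_exp_letterLoss_le`), and the
power constraint removes the `c`-term from the sum. Hence the set is typical up to `e^{-cn}`. Since
`ε_n` eventually exceeds every such exponential, the bound for `ε_n` follows too. -/

/-! ### Product integrals and the density of the observations. -/

theorem lintegral_pi_prod_eq_prod {n : ℕ} {α : Type*} [MeasurableSpace α] (μ : Measure α)
    [SigmaFinite μ] {f : Fin n → α → ℝ≥0∞} (hf : ∀ i, Measurable (f i)) :
    ∫⁻ x, ∏ i, f i (x i) ∂(Measure.pi fun _ : Fin n => μ) = ∏ i, ∫⁻ x, f i x ∂μ := by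
  induction n with
  | zero => simp
  | succ n ih =>
    rw [← ((measurePreserving_piFinSuccAbove (fun _ : Fin (n + 1) => μ) 0).symm).lintegral_comp_emb
      (MeasurableEquiv.measurableEmbedding _)]
    simp only [MeasurableEquiv.piFinSuccAbove_symm_apply, Fin.insertNthEquiv,
      Fin.prod_univ_succ, Fin.insertNth_zero, Equiv.coe_fn_mk, Fin.cons_succ,
      Fin.zero_succAbove, Fin.cons_zero]
    rw [← ih fun i => hf i.succ]
    exact lintegral_prod_mul (μ := μ) (ν := Measure.pi fun _ : Fin n => μ)
      (g := fun y : Fin n → α => ∏ i, f i.succ (y i)) (hf 0).aemeasurable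
      (Finset.measurable_prod _ fun i _ =>
        (hf i.succ).comp (measurable_pi_apply i)).aemeasurable

theorem pi_gaussianReal_eq_withDensity {n : ℕ} {v : ℝ≥0} (hv : v ≠ 0) :
    (Measure.pi fun _ : Fin n => gaussianReal 0 v) =
      (volume : Measure (Fin n → ℝ)).withDensity fun u => ∏ i, gaussianPDF 0 v (u i) := by
  refine Measure.pi_eq fun s hs => ?_
  rw [withDensity_apply _ (MeasurableSet.univ_pi hs),
    ← lintegral_indicator (MeasurableSet.univ_pi hs)]
  have h : ∀ u : Fin n → ℝ, (Set.univ.pi s).indicator (fun u => ∏ i, gaussianPDF 0 v (u i)) u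
      = ∏ i, (s i).indicator (gaussianPDF 0 v) (u i) := by
    intro u
    by_cases hu : u ∈ Set.univ.pi s
    · rw [Set.indicator_of_mem hu]
      exact Finset.prod_congr rfl fun i _ => (Set.indicator_of_mem (hu i trivial) _).symm
    · rw [Set.indicator_of_notMem hu]
      simp only [Set.mem_univ_pi, not_forall] at hu
      obtain ⟨i, hi⟩ := hu
      exact (Finset.prod_eq_zero (Finset.mem_univ i) (Set.indicator_of_notMem hi _)).symm
  simp_rw [h]
  rw [volume_pi, lintegral_pi_prod_eq_prod _
    fun i => (measurable_gaussianPDF 0 v).indicator (hs i)]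
  refine Finset.prod_congr rfl fun i _ => ?_
  rw [lintegral_indicator (hs i), gaussianReal_apply _ hv]

/-- The reference measure for the densities of the observations. -/
noncomputable abbrev obsRef (lawT lawE : Measure ℝ) (n : ℕ) : Measure (Obs n) :=
  (volume : Measure (Fin n → ℝ)).prod
    ((Measure.pi fun _ : Fin n => lawT).prod (Measure.pi fun _ : Fin n => lawE))

/-- The density of the observations given the codeword `x`. -/
noncomputable def obsDensity (σ : ℝ) {n : ℕ} (x : Fin n → ℝ) (p : Obs n) : ℝ≥0∞ :=
  ∏ i, gaussianPDF (p.2.2 i * x i) (Real.toNNReal (σ ^ 2)) (p.1 i)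

theorem measurable_obsDensity (σ : ℝ) {n : ℕ} (x : Fin n → ℝ) :
    Measurable (obsDensity σ x) := by
  refine Finset.measurable_prod _ fun i _ => ?_
  have h : Measurable fun p : Obs n =>
      (p.2.2 i * x i, Real.toNNReal (σ ^ 2), p.1 i) := by fun_prop
  exact measurable_uncurry_gaussianPDF.comp h

theorem toNNReal_sq_ne_zero {σ : ℝ} (hσ : 0 < σ) : Real.toNNReal (σ ^ 2) ≠ 0 := by
  simp only [ne_eq, Real.toNNReal_eq_zero, not_le]
  positivity

theorem measurable_obsMap {n : ℕ} (x : Fin n → ℝ) :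
    Measurable fun q : ((Fin n → ℝ) × (Fin n → ℝ)) × (Fin n → ℝ) =>
      ((fun i => q.1.2 i * x i + q.2 i, q.1.1, q.1.2) : Obs n) := by
  fun_prop

instance isProbabilityMeasure_obsLaw (σ : ℝ) (lawT lawE : Measure ℝ) [IsProbabilityMeasure lawT]
    [IsProbabilityMeasure lawE] {n : ℕ} (x : Fin n → ℝ) :
    IsProbabilityMeasure (obsLaw σ lawT lawE x) :=
  Measure.isProbabilityMeasure_map (measurable_obsMap x).aemeasurable

theorem obsLaw_eq_withDensity {σ : ℝ} (hσ : 0 < σ) (lawT lawE : Measure ℝ)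
    [IsProbabilityMeasure lawT] [IsProbabilityMeasure lawE] {n : ℕ} (x : Fin n → ℝ) :
    obsLaw σ lawT lawE x = (obsRef lawT lawE n).withDensity (obsDensity σ x) := by
  have hv := toNNReal_sq_ne_zero hσ
  have hpdf : Measurable fun u : Fin n → ℝ =>
      ∏ i, gaussianPDF 0 (Real.toNNReal (σ ^ 2)) (u i) :=
    Finset.measurable_prod _ fun i _ => (measurable_gaussianPDF _ _).comp (measurable_pi_apply i)
  refine Measure.ext_of_lintegral _ fun F hF => ?_
  rw [obsLaw, lintegral_map hF (measurable_obsMap x),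
    lintegral_withDensity_eq_lintegral_mul _ (measurable_obsDensity σ x) hF,
    lintegral_prod (fun q : ((Fin n → ℝ) × (Fin n → ℝ)) × (Fin n → ℝ) =>
      F (fun i => q.1.2 i * x i + q.2 i, q.1.1, q.1.2))
      (hF.comp (measurable_obsMap x)).aemeasurable,
    lintegral_prod_symm _ ((measurable_obsDensity σ x).mul hF).aemeasurable]
  refine lintegral_congr fun q => ?_
  rw [pi_gaussianReal_eq_withDensity hv, lintegral_withDensity_eq_lintegral_mul _ hpdf
    (show Measurable fun y : Fin n → ℝ => F (fun i => q.2 i * x i + y i, q.1, q.2) by fun_prop)]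
  -- Translation invariance of Lebesgue measure: substitute `z = hx + u`.
  rw [← lintegral_add_left_eq_self (fun z => (obsDensity σ x * F) (z, q)) (fun i => q.2 i * x i)]
  refine lintegral_congr fun u => ?_
  simp only [Pi.mul_apply, obsDensity, Pi.add_apply]
  congr 1
  refine Finset.prod_congr rfl fun i _ => ?_
  simp [gaussianPDF, gaussianPDFReal]

/-! ### Max-information from a dominating density. -/

theorem isTypical_mono {M Z : Type*} [MeasurableSpace Z] {W : M → Measure Z} {ε ε' : ℝ} {T : Set (M × Z)} (h : IsTypical W ε T)
    (hε : ε ≤ ε') : IsTypical W ε' T :=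
  ⟨h.1, fun m => le_trans (by linarith) (h.2 m)⟩

section MaxInfo

variable {M Z : Type*} [Fintype M] [MeasurableSpace Z]

theorem measurable_postProb (W : M → Measure Z) (m : M) : Measurable (postProb W m) :=
  Measure.measurable_rnDeriv _ _

/-- If the conditional laws have densities dominated on `T` by a common function of integral at
most `e ^ r`, then the max-information on `T` is at most `r / log 2`. -/
theorem maxInfoOn_le_of_density_le [Nonempty M] {W : M → Measure Z} {ν : Measure Z} [SigmaFinite ν]
    {f : M → Z → ℝ≥0∞} (hf : ∀ m, Measurable (f m)) (hW : ∀ m, W m = ν.withDensity (f m))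
    {T : Set (M × Z)} (hT : ∀ m, MeasurableSet {z | (m, z) ∈ T}) {g : Z → ℝ≥0∞}
    (hg : Measurable g) (hfg : ∀ m z, (m, z) ∈ T → f m z ≤ g z) {r : ℝ}
    (hr : ∫⁻ z, g z ∂ν ≤ ENNReal.ofReal (Real.exp r)) :
    maxInfoOn W T ≤ ((r / Real.log 2 : ℝ) : EReal) := by
  set c : ℝ≥0∞ := (Fintype.card M : ℝ≥0∞)⁻¹ with hc
  have hφ : Measurable fun z => c * ∑ m, f m z :=
    (Finset.measurable_sum _ fun m _ => hf m).const_mul c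
  have ho : outputLaw W = ν.withDensity fun z => c * ∑ m, f m z := by
    ext s hs
    simp only [outputLaw, hW, Measure.smul_apply, smul_eq_mul, Measure.finsetSum_apply,
      withDensity_apply _ hs]
    rw [lintegral_const_mul _ (Finset.measurable_sum _ fun m _ => hf m),
      lintegral_finsetSum _ fun m _ => hf m]
  -- Bayes' rule. The inequality is enough here, and it avoids any appeal to absolute continuity.
  have hpost : ∀ m, (fun z => (c * ∑ m, f m z) * postProb W m z) ≤ᵐ[ν] fun z => c * f m z := by
    intro m
    refine ae_le_of_forall_setLIntegral_le_of_sigmaFinite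
      (hφ.mul (measurable_postProb W m)) fun s hs _ => ?_
    have h := Measure.withDensity_rnDeriv_le (c • W m) (outputLaw W) s
    rw [withDensity_apply _ hs, ho, restrict_withDensity hs,
      lintegral_withDensity_eq_lintegral_mul _ hφ (Measure.measurable_rnDeriv _ _),
      Measure.smul_apply, hW, withDensity_apply _ hs, smul_eq_mul,
      ← lintegral_const_mul _ (hf m)] at h
    simpa only [postProb, ho, Pi.mul_apply, ← hW, ← hc] using h
  have hS : Measurable fun z =>
      ⨆ m : M, T.indicator (fun p => postProb W p.1 p.2) (m, z) := by
    refine Measurable.iSup fun m => ?_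
    have := (measurable_postProb W m).indicator (hT m)
    exact this
  have hI : ∫⁻ z, ⨆ m : M, T.indicator (fun p => postProb W p.1 p.2) (m, z) ∂(outputLaw W)
      ≤ c * ENNReal.ofReal (Real.exp r) := by
    refine le_trans ?_ (mul_le_mul_right hr c)
    rw [← lintegral_const_mul _ hg]
    conv_lhs => rw [ho]
    rw [lintegral_withDensity_eq_lintegral_mul _ hφ hS]
    refine lintegral_mono_ae ?_
    filter_upwards [ae_all_iff.2 hpost] with z hz
    simp only [Pi.mul_apply, ENNReal.mul_iSup]
    refine iSup_le fun m => ?_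
    by_cases hm : (m, z) ∈ T
    · rw [Set.indicator_of_mem hm]
      exact (hz m).trans (mul_le_mul_right (hfg m z hm) c)
    · simp [Set.indicator_of_notMem hm]
  have hl2 : 0 < Real.log 2 := Real.log_pos one_lt_two
  have hcard : (0 : ℝ) < Fintype.card M := by exact_mod_cast Fintype.card_pos
  have hcard' : (Fintype.card M : ℝ≥0∞) = ENNReal.ofReal (Fintype.card M : ℝ) := by simp
  have h1 : log2 (Fintype.card M : ℝ≥0∞)
      = ((Real.log (Fintype.card M) / Real.log 2 : ℝ) : EReal) := by
    rw [log2, hcard', ENNReal.log_ofReal_of_pos hcard]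
    norm_cast
  have h2 : log2 (c * ENNReal.ofReal (Real.exp r))
      = (((r - Real.log (Fintype.card M)) / Real.log 2 : ℝ) : EReal) := by
    rw [log2, hc, hcard', ← ENNReal.ofReal_inv_of_pos hcard,
      ← ENNReal.ofReal_mul (by positivity), ENNReal.log_ofReal_of_pos (by positivity),
      Real.log_mul (by positivity) (Real.exp_pos r).ne', Real.log_exp, Real.log_inv]
    rw [← EReal.coe_div]
    congr 2
    ring
  have hmono : Monotone log2 := fun a b hab =>
    EReal.div_le_div_right_of_nonneg (by exact_mod_cast hl2.le) (ENNReal.log_monotone hab)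
  rw [maxInfoOn, condMinEntropyOn, sub_eq_add_neg, neg_neg]
  refine (add_le_add_right (hmono hI) _).trans ?_
  rw [h1, h2]
  norm_cast
  rw [← add_div]
  simp

theorem smoothMaxInfo_anti (W : M → Measure Z) : Antitone (smoothMaxInfo W) := fun _ _ hε =>
  le_iInf fun T => iInf_le_of_le ⟨T.1, isTypical_mono T.2 hε⟩ le_rfl

end MaxInfo

/-! ### Exponential moments and the Chernoff bound. -/

theorem exp_le_one_add_add_sq_mul_exp_abs (y : ℝ) :
    Real.exp y ≤ 1 + y + y ^ 2 * Real.exp |y| := by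
  have h := Complex.norm_exp_sub_sum_le_norm_mul_exp (y : ℂ) 2
  simp only [Finset.sum_range_succ, Finset.sum_range_zero, pow_zero, pow_one, Nat.factorial,
    Complex.norm_real, Real.norm_eq_abs, sq_abs] at h
  have h' : Complex.exp (y : ℂ) - (0 + 1 / ((1 : ℕ) : ℂ) + (y : ℂ) / ((Nat.succ 0 * 1 : ℕ) : ℂ))
      = ((Real.exp y - (1 + y) : ℝ) : ℂ) := by
    push_cast
    simp
  rw [h', Complex.norm_real, Real.norm_eq_abs] at h
  linarith [le_abs_self (Real.exp y - (1 + y))]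

theorem lintegral_exp_mul_le {Ω : Type*} [MeasurableSpace Ω] (μ : Measure Ω)
    [IsProbabilityMeasure μ] {V : Ω → ℝ} (hV : Integrable V μ) {s D : ℝ}
    (hi : Integrable (fun w => V w ^ 2 * Real.exp (|s| * |V w|)) μ)
    (hD : ∫ w, V w ^ 2 * Real.exp (|s| * |V w|) ∂μ ≤ D) :
    ∫⁻ w, ENNReal.ofReal (Real.exp (s * V w)) ∂μ
      ≤ ENNReal.ofReal (Real.exp (s * ∫ w, V w ∂μ + s ^ 2 * D)) := by
  have hp : ∀ w, Real.exp (s * V w)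
      ≤ 1 + s * V w + s ^ 2 * (V w ^ 2 * Real.exp (|s| * |V w|)) := fun w => by
    have := exp_le_one_add_add_sq_mul_exp_abs (s * V w)
    rw [abs_mul] at this
    linarith
  have hI0 : Integrable (fun w => 1 + s * V w) μ := (integrable_const _).add (hV.const_mul s)
  have hI : Integrable (fun w => 1 + s * V w + s ^ 2 * (V w ^ 2 * Real.exp (|s| * |V w|))) μ :=
    hI0.add (hi.const_mul _)
  calc ∫⁻ w, ENNReal.ofReal (Real.exp (s * V w)) ∂μ
      ≤ ∫⁻ w, ENNReal.ofReal
          (1 + s * V w + s ^ 2 * (V w ^ 2 * Real.exp (|s| * |V w|))) ∂μ :=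
        lintegral_mono fun w => ENNReal.ofReal_le_ofReal (hp w)
    _ = ENNReal.ofReal
          (∫ w, (1 + s * V w + s ^ 2 * (V w ^ 2 * Real.exp (|s| * |V w|))) ∂μ) :=
        (ofReal_integral_eq_lintegral_ofReal hI
          (Eventually.of_forall fun w => (Real.exp_pos _).le.trans (hp w))).symm
    _ ≤ _ := by
        refine ENNReal.ofReal_le_ofReal ?_
        rw [integral_add hI0 (hi.const_mul _),
          integral_add (integrable_const _) (hV.const_mul s), integral_const_mul,
          integral_const_mul]
        simp only [integral_const, probReal_univ, smul_eq_mul, mul_one]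
        have h1 := mul_le_mul_of_nonneg_left hD (sq_nonneg s)
        have h2 := Real.add_one_le_exp (s * ∫ w, V w ∂μ + s ^ 2 * D)
        linarith

/-- In the coordinates `(h_i, z_i - h_i x_i)`, that is coefficient and noise, the channel uses are
independent and no longer depend on `x`. -/
theorem lintegral_obsLaw_prod (σ : ℝ) (lawT lawE : Measure ℝ) [IsProbabilityMeasure lawT]
    [IsProbabilityMeasure lawE] {n : ℕ} (x : Fin n → ℝ) {G : Fin n → ℝ × ℝ → ℝ≥0∞}
    (hG : ∀ i, Measurable (G i)) :
    ∫⁻ p, ∏ i, G i (p.2.2 i, p.1 i - p.2.2 i * x i) ∂(obsLaw σ lawT lawE x)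
      = ∏ i, ∫⁻ q, G i q ∂(lawE.prod (gaussianReal 0 (Real.toNNReal (σ ^ 2)))) := by
  have hm : Measurable fun p : Obs n => ∏ i, G i (p.2.2 i, p.1 i - p.2.2 i * x i) :=
    Finset.measurable_prod _ fun i _ => (hG i).comp (by fun_prop)
  have hm' : Measurable fun q : ((Fin n → ℝ) × (Fin n → ℝ)) × (Fin n → ℝ) =>
      ∏ i, G i (q.1.2 i, q.2 i) :=
    Finset.measurable_prod _ fun i _ => (hG i).comp (by fun_prop)
  rw [obsLaw, lintegral_map hm (measurable_obsMap x)]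
  simp only [add_sub_cancel_left]
  rw [lintegral_prod _ hm'.aemeasurable]
  have h1 : ∀ a : (Fin n → ℝ) × (Fin n → ℝ),
      ∫⁻ u, ∏ i, G i (a.2 i, u i)
          ∂(Measure.pi fun _ : Fin n => gaussianReal 0 (Real.toNNReal (σ ^ 2)))
        = ∏ i, ∫⁻ u, G i (a.2 i, u) ∂(gaussianReal 0 (Real.toNNReal (σ ^ 2))) := fun a =>
    lintegral_pi_prod_eq_prod _ (f := fun i u => G i (a.2 i, u))
      fun i => (hG i).comp measurable_prodMk_left
  simp only [h1]
  have h2 : ∀ i, Measurable fun h : ℝ =>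
      ∫⁻ u, G i (h, u) ∂(gaussianReal 0 (Real.toNNReal (σ ^ 2))) :=
    fun i => (hG i).lintegral_prod_right'
  have h3 : Measurable fun a : (Fin n → ℝ) × (Fin n → ℝ) =>
      ∏ i, ∫⁻ u, G i (a.2 i, u) ∂(gaussianReal 0 (Real.toNNReal (σ ^ 2))) :=
    Finset.measurable_prod _ fun i _ => (h2 i).comp (by fun_prop)
  rw [lintegral_prod _ h3.aemeasurable]
  simp only [lintegral_const, measure_univ, mul_one]
  rw [lintegral_pi_prod_eq_prod lawE h2]
  exact Finset.prod_congr rfl fun i _ => (lintegral_prod _ (hG i).aemeasurable).symm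

theorem measurableSet_le_sum {n : ℕ} (x : Fin n → ℝ) {F : Fin n → ℝ × ℝ → ℝ}
    (hF : ∀ i, Measurable (F i)) (t : ℝ) :
    MeasurableSet {p : Obs n | t ≤ ∑ i, F i (p.2.2 i, p.1 i - p.2.2 i * x i)} :=
  measurableSet_le measurable_const
    (Finset.measurable_sum _ fun i _ => (hF i).comp (by fun_prop))

/-- Chernoff bound for sums of functions of the channel coefficients and the noise. -/
theorem obsLaw_le_sum_le (σ : ℝ) (lawT lawE : Measure ℝ) [IsProbabilityMeasure lawT]
    [IsProbabilityMeasure lawE] {n : ℕ} (x : Fin n → ℝ) {F : Fin n → ℝ × ℝ → ℝ}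
    (hF : ∀ i, Measurable (F i)) {a : Fin n → ℝ}
    (ha : ∀ i, ∫⁻ q, ENNReal.ofReal (Real.exp (F i q))
      ∂(lawE.prod (gaussianReal 0 (Real.toNNReal (σ ^ 2)))) ≤ ENNReal.ofReal (Real.exp (a i)))
    (t : ℝ) :
    (obsLaw σ lawT lawE x).real {p | t ≤ ∑ i, F i (p.2.2 i, p.1 i - p.2.2 i * x i)}
      ≤ Real.exp (∑ i, a i - t) := by
  have hG : ∀ i, Measurable fun q => ENNReal.ofReal (Real.exp (F i q)) := fun i =>
    (Real.measurable_exp.comp (hF i)).ennreal_ofReal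
  have hm : Measurable fun p : Obs n =>
      ∏ i, ENNReal.ofReal (Real.exp (F i (p.2.2 i, p.1 i - p.2.2 i * x i))) :=
    Finset.measurable_prod _ fun i _ => (hG i).comp (by fun_prop)
  have h1 := mul_meas_ge_le_lintegral (μ := obsLaw σ lawT lawE x) hm
    (ENNReal.ofReal (Real.exp t))
  rw [lintegral_obsLaw_prod σ lawT lawE x hG] at h1
  have hset : {p : Obs n | ENNReal.ofReal (Real.exp t)
        ≤ ∏ i, ENNReal.ofReal (Real.exp (F i (p.2.2 i, p.1 i - p.2.2 i * x i)))}
      = {p | t ≤ ∑ i, F i (p.2.2 i, p.1 i - p.2.2 i * x i)} := by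
    ext p
    simp only [Set.mem_ofPred_eq]
    rw [← ENNReal.ofReal_prod_of_nonneg fun i _ => (Real.exp_pos _).le, ← Real.exp_sum,
      ENNReal.ofReal_le_ofReal_iff (Real.exp_pos _).le, Real.exp_le_exp]
  have h2 : ∏ i, ∫⁻ q, ENNReal.ofReal (Real.exp (F i q))
      ∂(lawE.prod (gaussianReal 0 (Real.toNNReal (σ ^ 2))))
      ≤ ENNReal.ofReal (Real.exp (∑ i, a i)) := by
    rw [Real.exp_sum, ENNReal.ofReal_prod_of_nonneg fun i _ => (Real.exp_pos _).le]
    exact Finset.prod_le_prod' fun i _ => ha i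
  rw [hset] at h1
  have h3 := ENNReal.toReal_mono ENNReal.ofReal_ne_top (h1.trans h2)
  rw [ENNReal.toReal_mul, ENNReal.toReal_ofReal (Real.exp_pos _).le,
    ENNReal.toReal_ofReal (Real.exp_pos _).le] at h3
  rw [Real.exp_sub, le_div_iff₀ (Real.exp_pos t), mul_comm]
  exact h3

section ExpMoments

variable {Ω : Type*} [MeasurableSpace Ω] {μ : Measure Ω} {V : Ω → ℝ} {γ : ℝ}

theorem pow_le_factorial_div_mul_exp {v : ℝ} (hv : 0 ≤ v) (hγ : 0 < γ) (k : ℕ) :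
    v ^ k ≤ k.factorial / γ ^ k * Real.exp (γ * v) := by
  have h := Real.pow_div_factorial_le_exp (γ * v) (by positivity) k
  rw [div_le_iff₀ (by positivity), mul_pow] at h
  rw [div_mul_eq_mul_div, le_div_iff₀ (by positivity)]
  linarith

theorem integrable_pow_mul_exp (hm : Measurable V) (h0 : ∀ w, 0 ≤ V w)
    (hi : Integrable (fun w => Real.exp (γ * V w)) μ) {s : ℝ} (hs : s < γ) (k : ℕ) :
    Integrable (fun w => V w ^ k * Real.exp (s * V w)) μ := by
  refine (hi.const_mul (k.factorial / (γ - s) ^ k)).mono'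
    (((hm.pow_const k).mul (Real.measurable_exp.comp (hm.const_mul s))).aestronglyMeasurable)
    (Eventually.of_forall fun w => ?_)
  have h := pow_le_factorial_div_mul_exp (h0 w) (sub_pos.2 hs) k
  have h' := h0 w
  rw [Real.norm_of_nonneg (by positivity)]
  calc V w ^ k * Real.exp (s * V w)
      ≤ (k.factorial / (γ - s) ^ k * Real.exp ((γ - s) * V w)) * Real.exp (s * V w) := by gcongr
    _ = k.factorial / (γ - s) ^ k * Real.exp (γ * V w) := by
        rw [mul_assoc, ← Real.exp_add]
        ring_nf

theorem integrable_pow_of_exp (hm : Measurable V) (h0 : ∀ w, 0 ≤ V w) (hγ : 0 < γ)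
    (hi : Integrable (fun w => Real.exp (γ * V w)) μ) (k : ℕ) :
    Integrable (fun w => V w ^ k) μ := by
  simpa using integrable_pow_mul_exp hm h0 hi hγ k

theorem integrable_of_exp (hm : Measurable V) (h0 : ∀ w, 0 ≤ V w) (hγ : 0 < γ)
    (hi : Integrable (fun w => Real.exp (γ * V w)) μ) : Integrable V μ := by
  simpa using integrable_pow_of_exp hm h0 hγ hi 1

variable [IsProbabilityMeasure μ]

theorem one_le_integral_exp (h0 : ∀ w, 0 ≤ V w) (hγ : 0 < γ)
    (hi : Integrable (fun w => Real.exp (γ * V w)) μ) : 1 ≤ ∫ w, Real.exp (γ * V w) ∂μ := by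
  have h : ∫ _, (1 : ℝ) ∂μ ≤ ∫ w, Real.exp (γ * V w) ∂μ :=
    integral_mono (integrable_const _) hi fun w => Real.one_le_exp (mul_nonneg hγ.le (h0 w))
  simpa using h

/-- Bounds every admissible `K` from below through a mean, which keeps the Chernoff parameter `δ /
K` below `γ / 2` for all codebooks at once. -/
theorem two_mul_sq_integral_le_tailConst (hm : Measurable V) (h0 : ∀ w, 0 ≤ V w) (hγ : 0 < γ)
    (hi : Integrable (fun w => Real.exp (γ * V w)) μ) :
    2 * (∫ w, V w ∂μ) ^ 2 ≤ tailConst μ γ V := by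
  set v := ∫ w, V w ∂μ with hv
  have hV := integrable_of_exp hm h0 hγ hi
  have h4 := integrable_pow_of_exp hm h0 hγ hi 4
  have hv0 : 0 ≤ v := integral_nonneg h0
  have h1 : v ^ 4 ≤ ∫ w, V w ^ 4 ∂μ := by
    -- Jensen via the tangent of `t⁴` at the mean; the gap is `(V-v)²(V²+2vV+3v²)`.
    have : ∫ w, (4 * v ^ 3 * V w - 3 * v ^ 4) ∂μ ≤ ∫ w, V w ^ 4 ∂μ := by
      refine integral_mono ((hV.const_mul _).sub (integrable_const _)) h4 fun w => ?_
      have := h0 w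
      nlinarith [mul_nonneg (sq_nonneg (V w - v))
        (by positivity : 0 ≤ V w ^ 2 + 2 * v * V w + 3 * v ^ 2)]
    rw [integral_sub (hV.const_mul _) (integrable_const _), integral_const_mul, ← hv] at this
    simp only [integral_const, probReal_univ, smul_eq_mul, one_mul] at this
    linarith
  have h2 : v ^ 2 ≤ Real.sqrt (∫ w, V w ^ 4 ∂μ) := by
    refine Real.le_sqrt_of_sq_le ?_
    rw [← pow_mul]
    exact h1
  have h3 : 1 ≤ ∫ w, Real.exp (γ * |V w|) ∂μ := by
    simpa only [abs_of_nonneg (h0 _)] using one_le_integral_exp h0 hγ hi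
  rw [tailConst]
  calc 2 * v ^ 2 = 2 * v ^ 2 * 1 := by ring
    _ ≤ _ := by gcongr

/-- Cauchy–Schwarz for `V²` and `e^{sV}`, in the form `ab ≤ a²/(2t) + t b²/2`, together with `2s ≤
γ` and `1 ≤ B`. -/
theorem integral_sq_mul_exp_le_tailConst (hm : Measurable V) (h0 : ∀ w, 0 ≤ V w) (hγ : 0 < γ)
    (hi : Integrable (fun w => Real.exp (γ * V w)) μ) {s : ℝ} (hs : 2 * s ≤ γ) :
    ∫ w, V w ^ 2 * Real.exp (s * V w) ∂μ ≤ tailConst μ γ V / 2 := by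
  have h4 := integrable_pow_of_exp hm h0 hγ hi 4
  set A := ∫ w, V w ^ 4 ∂μ with hA
  set B := ∫ w, Real.exp (γ * V w) ∂μ with hB
  have hB1 : 1 ≤ B := one_le_integral_exp h0 hγ hi
  have htail : tailConst μ γ V / 2 = Real.sqrt A * B := by
    simp only [tailConst, abs_of_nonneg (h0 _)]
    ring
  have hA0 : 0 ≤ A := integral_nonneg fun w => by have := h0 w; positivity
  have hr := Real.sqrt_nonneg A
  rw [htail]
  refine le_of_forall_pos_le_add fun e he => ?_
  -- The optimal weight is of order `√A`; the extra `e / B` keeps it positive when `A = 0`.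
  set t := Real.sqrt A + e / B with ht
  have ht0 : 0 < t := by positivity
  have h1 : ∫ w, V w ^ 2 * Real.exp (s * V w) ∂μ
      ≤ ∫ w, ((1 / (2 * t)) * V w ^ 4 + t / 2 * Real.exp (γ * V w)) ∂μ := by
    refine integral_mono (integrable_pow_mul_exp hm h0 hi (by linarith) 2)
      ((h4.const_mul _).add (hi.const_mul _)) fun w => ?_
    have hV := h0 w
    have h2 : Real.exp (s * V w) ^ 2 ≤ Real.exp (γ * V w) := by
      rw [← Real.exp_nat_mul]
      refine Real.exp_le_exp.2 ?_
      push_cast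
      nlinarith
    have h3 : V w ^ 2 * Real.exp (s * V w)
        ≤ 1 / (2 * t) * V w ^ 4 + t / 2 * Real.exp (s * V w) ^ 2 := by
      have h5 : 0 ≤ (V w ^ 2 - t * Real.exp (s * V w)) ^ 2 / (2 * t) := by positivity
      have h6 : (V w ^ 2 - t * Real.exp (s * V w)) ^ 2 / (2 * t)
          = 1 / (2 * t) * V w ^ 4 + t / 2 * Real.exp (s * V w) ^ 2
            - V w ^ 2 * Real.exp (s * V w) := by
        field_simp
        ring
      linarith
    have h7 : t / 2 * Real.exp (s * V w) ^ 2 ≤ t / 2 * Real.exp (γ * V w) := by gcongr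
    exact h3.trans (by linarith)
  rw [integral_add (h4.const_mul _) (hi.const_mul _), integral_const_mul, integral_const_mul,
    ← hA, ← hB] at h1
  have h2 : 1 / (2 * t) * A ≤ Real.sqrt A / 2 := by
    rw [one_div_mul_eq_div, div_le_div_iff₀ (by positivity) two_pos]
    have : Real.sqrt A * Real.sqrt A = A := Real.mul_self_sqrt hA0
    have : 0 ≤ Real.sqrt A * (e / B) := by positivity
    rw [ht]
    nlinarith
  have h3 : t / 2 * B = Real.sqrt A * B / 2 + e / 2 := by
    rw [ht]
    field_simp
  nlinarith [mul_le_mul_of_nonneg_left hB1 hr]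

theorem lintegral_exp_mul_le_of_tailConst_le (hm : Measurable V) (h0 : ∀ w, 0 ≤ V w) (hγ : 0 < γ)
    (hi : Integrable (fun w => Real.exp (γ * V w)) μ) {s K : ℝ} (hs : 2 * |s| ≤ γ)
    (hK : tailConst μ γ V ≤ K) :
    ∫⁻ w, ENNReal.ofReal (Real.exp (s * V w)) ∂μ
      ≤ ENNReal.ofReal (Real.exp (s * ∫ w, V w ∂μ + s ^ 2 * (K / 2))) := by
  refine lintegral_exp_mul_le μ (integrable_of_exp hm h0 hγ hi) ?_ ?_
  · simp only [abs_of_nonneg (h0 _)]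
    exact integrable_pow_mul_exp hm h0 hi (by linarith [abs_nonneg s]) 2
  · simp only [abs_of_nonneg (h0 _)]
    exact (integral_sq_mul_exp_le_tailConst hm h0 hγ hi hs).trans (by linarith)

end ExpMoments

/-! ### Gaussian integrals. -/

section Gaussian

variable {σ : ℝ}

theorem coe_toNNReal_sq (σ : ℝ) : ((Real.toNNReal (σ ^ 2) : ℝ≥0) : ℝ) = σ ^ 2 :=
  Real.coe_toNNReal _ (sq_nonneg σ)

theorem lintegral_exp_sq_gaussianReal (hσ : 0 < σ) {b : ℝ} (hb : b < 1 / 2) :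
    ∫⁻ u, ENNReal.ofReal (Real.exp (b * (u ^ 2 / σ ^ 2)))
      ∂(gaussianReal 0 (Real.toNNReal (σ ^ 2))) = ENNReal.ofReal (Real.sqrt (1 - 2 * b))⁻¹ := by
  rw [gaussianReal_of_var_ne_zero _ (toNNReal_sq_ne_zero hσ),
    lintegral_withDensity_eq_lintegral_mul _ (measurable_gaussianPDF _ _) (by fun_prop)]
  have h : ∀ u : ℝ, (gaussianPDF 0 (Real.toNNReal (σ ^ 2)) * fun u =>
        ENNReal.ofReal (Real.exp (b * (u ^ 2 / σ ^ 2)))) u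
      = ENNReal.ofReal ((Real.sqrt (2 * Real.pi * σ ^ 2))⁻¹ *
          Real.exp (-((1 - 2 * b) / (2 * σ ^ 2)) * u ^ 2)) := by
    intro u
    rw [Pi.mul_apply, gaussianPDF, ← ENNReal.ofReal_mul (gaussianPDFReal_nonneg _ _ _),
      gaussianPDFReal, coe_toNNReal_sq, mul_assoc, ← Real.exp_add]
    congr 3
    field_simp
    ring
  simp only [h]
  have hpos : 0 < (1 - 2 * b) / (2 * σ ^ 2) := div_pos (by linarith) (by positivity)
  rw [← ofReal_integral_eq_lintegral_ofReal ((integrable_exp_neg_mul_sq hpos).const_mul _)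
    (Eventually.of_forall fun u => by positivity), integral_const_mul, integral_gaussian]
  congr 1
  rw [← Real.sqrt_inv, ← Real.sqrt_inv, ← Real.sqrt_mul (by positivity)]
  congr 1
  have : 1 - 2 * b ≠ 0 := by linarith
  field_simp

theorem integrable_exp_sq_gaussianReal (hσ : 0 < σ) {b : ℝ} (hb : b < 1 / 2) :
    Integrable (fun u => Real.exp (b * (u ^ 2 / σ ^ 2)))
      (gaussianReal 0 (Real.toNNReal (σ ^ 2))) := by
  rw [← lintegral_ofReal_ne_top_iff_integrable (by fun_prop)
    (Eventually.of_forall fun u => (Real.exp_pos _).le), lintegral_exp_sq_gaussianReal hσ hb]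
  exact ENNReal.ofReal_ne_top

theorem integrable_sq_gaussianReal (σ : ℝ) :
    Integrable (fun u : ℝ => u ^ 2) (gaussianReal 0 (Real.toNNReal (σ ^ 2))) :=
  (memLp_id_gaussianReal 2).integrable_sq

theorem integral_sq_gaussianReal (σ : ℝ) :
    ∫ u, u ^ 2 ∂(gaussianReal 0 (Real.toNNReal (σ ^ 2))) = σ ^ 2 := by
  have h := variance_fun_id_gaussianReal (μ := 0) (v := Real.toNNReal (σ ^ 2))
  rw [variance_of_integral_eq_zero (by fun_prop) integral_id_gaussianReal, coe_toNNReal_sq] at h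
  exact h

theorem integrable_id_gaussianReal (σ : ℝ) :
    Integrable (fun u : ℝ => u) (gaussianReal 0 (Real.toNNReal (σ ^ 2))) :=
  (memLp_id_gaussianReal 1).integrable le_rfl

theorem integral_add_sq_gaussianReal (σ a : ℝ) :
    ∫ u, (a + u) ^ 2 ∂(gaussianReal 0 (Real.toNNReal (σ ^ 2))) = a ^ 2 + σ ^ 2 := by
  have h : ∀ u : ℝ, (a + u) ^ 2 = (a ^ 2 + 2 * a * u) + u ^ 2 := fun u => by ring
  have hi : Integrable (fun u : ℝ => a ^ 2 + 2 * a * u)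
      (gaussianReal 0 (Real.toNNReal (σ ^ 2))) :=
    (integrable_const _).add ((integrable_id_gaussianReal σ).const_mul _)
  simp only [h]
  rw [integral_add hi (integrable_sq_gaussianReal σ),
    integral_add (integrable_const _) ((integrable_id_gaussianReal σ).const_mul _),
    integral_const_mul, integral_sq_gaussianReal, integral_id_gaussianReal]
  simp

end Gaussian

/-! ### Output power and log gain in one channel use. -/

/-- The law of the channel coefficient and the noise in one channel use. -/
noncomputable abbrev letterLaw (σ : ℝ) (lawE : Measure ℝ) : Measure (ℝ × ℝ) :=
  lawE.prod (gaussianReal 0 (Real.toNNReal (σ ^ 2)))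

/-- The normalised output power for the symbol `x`. -/
noncomputable def outPower (P σ x : ℝ) (q : ℝ × ℝ) : ℝ :=
  (q.1 * x + q.2) ^ 2 / (σ ^ 2 + q.1 ^ 2 * P)

/-- The derivative of the mean normalised output power with respect to the input power. -/
noncomputable def powerSlope (P σ : ℝ) (lawE : Measure ℝ) : ℝ :=
  ∫ h, h ^ 2 / (σ ^ 2 + h ^ 2 * P) ∂lawE

/-- The gain `log (1 + h² SNR)` of a channel coefficient. -/
noncomputable def logGain (P σ h : ℝ) : ℝ := Real.logb 2 (1 + h ^ 2 * (P / σ ^ 2))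

section Letter

variable {P σ : ℝ} (hP : 0 < P) (hσ : 0 < σ) (lawE : Measure ℝ) [IsProbabilityMeasure lawE]

theorem measurable_outPower (P σ x : ℝ) : Measurable (outPower P σ x) := by
  unfold outPower
  fun_prop

theorem measurable_logGain (P σ : ℝ) : Measurable (logGain P σ) := by
  unfold logGain Real.logb
  fun_prop

include hP hσ

theorem variance_pos (h : ℝ) : 0 < σ ^ 2 + h ^ 2 * P := by positivity

theorem outPower_nonneg (x : ℝ) (q : ℝ × ℝ) : 0 ≤ outPower P σ x q :=
  div_nonneg (sq_nonneg _) (variance_pos hP hσ _).le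

theorem logGain_nonneg (h : ℝ) : 0 ≤ logGain P σ h := by
  refine Real.logb_nonneg one_lt_two ?_
  have : 0 ≤ h ^ 2 * (P / σ ^ 2) := by positivity
  linarith

/-- Young's inequality with a free weight `θ`: the factor `1 + θ` on the noise can be taken close to
`1`, so that exponential moments exist for every order below `1/2`. -/
theorem outPower_le {θ : ℝ} (hθ : 0 < θ) (x : ℝ) (q : ℝ × ℝ) :
    outPower P σ x q ≤ (1 + 1 / θ) * (x ^ 2 / P) + (1 + θ) * (q.2 ^ 2 / σ ^ 2) := by
  have hv := variance_pos hP hσ q.1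
  have h1 : (q.1 * x + q.2) ^ 2 ≤ (1 + 1 / θ) * (q.1 * x) ^ 2 + (1 + θ) * q.2 ^ 2 := by
    have h : 0 ≤ (q.1 * x - θ * q.2) ^ 2 / θ := by positivity
    have h' : (q.1 * x - θ * q.2) ^ 2 / θ
        = 1 / θ * (q.1 * x) ^ 2 - 2 * (q.1 * x) * q.2 + θ * q.2 ^ 2 := by
      field_simp
      ring
    nlinarith
  have h2 : (q.1 * x) ^ 2 ≤ x ^ 2 / P * (σ ^ 2 + q.1 ^ 2 * P) := by
    have : x ^ 2 / P * (σ ^ 2 + q.1 ^ 2 * P) = x ^ 2 * σ ^ 2 / P + (q.1 * x) ^ 2 := by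
      field_simp
    rw [this]
    have : 0 ≤ x ^ 2 * σ ^ 2 / P := by positivity
    linarith
  have h3 : q.2 ^ 2 ≤ q.2 ^ 2 / σ ^ 2 * (σ ^ 2 + q.1 ^ 2 * P) := by
    have : q.2 ^ 2 / σ ^ 2 * (σ ^ 2 + q.1 ^ 2 * P)
        = q.2 ^ 2 + q.2 ^ 2 * q.1 ^ 2 * P / σ ^ 2 := by
      field_simp
    rw [this]
    have : 0 ≤ q.2 ^ 2 * q.1 ^ 2 * P / σ ^ 2 := by positivity
    linarith
  rw [outPower, div_le_iff₀ hv]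
  have h4 := mul_le_mul_of_nonneg_left h2 (by positivity : 0 ≤ 1 + 1 / θ)
  have h5 := mul_le_mul_of_nonneg_left h3 (by positivity : 0 ≤ 1 + θ)
  calc _ ≤ _ := h1
    _ ≤ _ := add_le_add h4 h5
    _ = _ := by ring

theorem integrable_exp_outPower {γ : ℝ} (hγ : 0 < γ) (hγ' : γ < 1 / 2) (x : ℝ) :
    Integrable (fun q => Real.exp (γ * outPower P σ x q)) (letterLaw σ lawE) := by
  -- Makes `γ(1+θ)` the midpoint of `γ` and `1/2`.
  set θ := (1 / (2 * γ) - 1) / 2 with hθ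
  have h1 : 1 < 1 / (2 * γ) := by
    rw [lt_div_iff₀ (by positivity)]
    linarith
  have hθ0 : 0 < θ := by linarith
  have h2 : γ * (1 + θ) < 1 / 2 := by
    have : γ * (1 + θ) = γ / 2 + 1 / 4 := by
      rw [hθ]
      field_simp
      ring
    linarith
  have hi := ((integrable_exp_sq_gaussianReal hσ h2).comp_snd lawE).const_mul
    (Real.exp (γ * ((1 + 1 / θ) * (x ^ 2 / P))))
  refine hi.mono' (Real.measurable_exp.comp
    ((measurable_outPower P σ x).const_mul γ)).aestronglyMeasurable
    (Eventually.of_forall fun q => ?_)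
  rw [Real.norm_of_nonneg (Real.exp_pos _).le, ← Real.exp_add]
  refine Real.exp_le_exp.2 ?_
  have := mul_le_mul_of_nonneg_left (outPower_le hP hσ hθ0 x q) hγ.le
  linarith

theorem integrable_powerSlope :
    Integrable (fun h : ℝ => h ^ 2 / (σ ^ 2 + h ^ 2 * P)) lawE := by
  refine (integrable_const (1 / P)).mono' (Measurable.aestronglyMeasurable (by fun_prop))
    (Eventually.of_forall fun h => ?_)
  have hv := variance_pos hP hσ h
  rw [Real.norm_of_nonneg (by positivity), div_le_div_iff₀ hv hP]
  nlinarith [sq_nonneg σ]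

/-- The integrand of `1 - κP` is `σ²/(σ²+h²P)`, positive everywhere because `σ > 0`. -/
theorem powerSlope_mul_lt_one : powerSlope P σ lawE * P < 1 := by
  have hi := integrable_powerSlope hP hσ lawE
  have h1 : ∫ h, (1 - h ^ 2 / (σ ^ 2 + h ^ 2 * P) * P) ∂lawE = 1 - powerSlope P σ lawE * P := by
    rw [integral_sub (integrable_const _) (hi.mul_const P), integral_mul_const, powerSlope]
    simp
  have hpos : ∀ h : ℝ, 0 < 1 - h ^ 2 / (σ ^ 2 + h ^ 2 * P) * P := fun h => by
    have hv := variance_pos hP hσ h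
    rw [sub_pos, div_mul_eq_mul_div, div_lt_one hv]
    linarith [sq_pos_of_pos hσ]
  have h2 : 0 < ∫ h, (1 - h ^ 2 / (σ ^ 2 + h ^ 2 * P) * P) ∂lawE := by
    rw [integral_pos_iff_support_of_nonneg (fun h => (hpos h).le)
      ((integrable_const _).sub (hi.mul_const P))]
    have : Function.support (fun h : ℝ => 1 - h ^ 2 / (σ ^ 2 + h ^ 2 * P) * P) = Set.univ :=
      Set.eq_univ_of_forall fun h => (hpos h).ne'
    rw [this, measure_univ]
    exact one_pos
  linarith

/-- Affine in `x²` with non-negative slope, so only the average power of a codeword matters. -/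
theorem integral_outPower (x : ℝ) :
    ∫ q, outPower P σ x q ∂(letterLaw σ lawE) = 1 + powerSlope P σ lawE * (x ^ 2 - P) := by
  have hi : Integrable (outPower P σ x) (letterLaw σ lawE) :=
    integrable_of_exp (γ := 1 / 4) (measurable_outPower P σ x) (outPower_nonneg hP hσ x)
      (by norm_num) (integrable_exp_outPower hP hσ lawE (by norm_num) (by norm_num) x)
  rw [integral_prod _ hi]
  have h1 : ∀ h : ℝ, ∫ u, outPower P σ x (h, u) ∂(gaussianReal 0 (Real.toNNReal (σ ^ 2)))
      = 1 + h ^ 2 / (σ ^ 2 + h ^ 2 * P) * (x ^ 2 - P) := fun h => by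
    have hv := (variance_pos hP hσ h).ne'
    simp only [outPower]
    rw [integral_div, integral_add_sq_gaussianReal]
    field_simp
    ring
  simp only [h1]
  rw [integral_add (integrable_const _) ((integrable_powerSlope hP hσ lawE).mul_const _),
    integral_mul_const, powerSlope]
  simp

/-- Since `logGain` is a base-2 logarithm, order `log 2` corresponds to the first power of `1 + h²
SNR`; a finite second moment of `H_E` therefore suffices. -/
theorem exp_logGain_le {γ : ℝ} (hγ : γ ≤ Real.log 2) (h : ℝ) :
    Real.exp (γ * logGain P σ h) ≤ 1 + h ^ 2 * (P / σ ^ 2) := by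
  have h0 := logGain_nonneg hP hσ h
  have h1 : 0 < 1 + h ^ 2 * (P / σ ^ 2) := by positivity
  have h2 : Real.log 2 * logGain P σ h = Real.log (1 + h ^ 2 * (P / σ ^ 2)) := by
    rw [logGain, Real.logb]
    field_simp
  calc Real.exp (γ * logGain P σ h) ≤ Real.exp (Real.log 2 * logGain P σ h) :=
        Real.exp_le_exp.2 (mul_le_mul_of_nonneg_right hγ h0)
    _ = _ := by rw [h2, Real.exp_log h1]

theorem integrable_exp_logGain (hE : Integrable (fun h : ℝ => h ^ 2) lawE) {γ : ℝ}
    (hγ : γ ≤ Real.log 2) : Integrable (fun h => Real.exp (γ * logGain P σ h)) lawE := by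
  refine ((integrable_const 1).add (hE.mul_const (P / σ ^ 2))).mono'
    (Real.measurable_exp.comp ((measurable_logGain P σ).const_mul γ)).aestronglyMeasurable
    (Eventually.of_forall fun h => ?_)
  rw [Real.norm_of_nonneg (Real.exp_pos _).le]
  exact exp_logGain_le hP hσ hγ h

end Letter

theorem powerSlope_nonneg {P σ : ℝ} (hP : 0 < P) (hσ : 0 < σ) (lawE : Measure ℝ) :
    0 ≤ powerSlope P σ lawE :=
  integral_nonneg fun h => div_nonneg (sq_nonneg h) (variance_pos hP hσ h).le

theorem half_lt_log_two : 1 / 2 < Real.log 2 := by linarith [Real.log_two_gt_d9]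

/-! ### Typicality of `T_n`. -/

section Typical

theorem lintegral_letterLaw_fst (σ : ℝ) (lawE : Measure ℝ) [IsProbabilityMeasure lawE] {f : ℝ → ℝ≥0∞}
    (hf : Measurable f) : ∫⁻ q, f q.1 ∂(letterLaw σ lawE) = ∫⁻ h, f h ∂lawE := by
  rw [lintegral_prod (fun q : ℝ × ℝ => f q.1) (hf.comp measurable_fst).aemeasurable]
  simp

theorem ae_obsLaw_nonneg (σ : ℝ) (lawT lawE : Measure ℝ) [IsProbabilityMeasure lawT]
    [IsProbabilityMeasure lawE] (hT : ∀ᵐ h ∂lawT, 0 ≤ h) (hE : ∀ᵐ h ∂lawE, 0 ≤ h)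
    {n : ℕ} (x : Fin n → ℝ) :
    ∀ᵐ p ∂(obsLaw σ lawT lawE x), (∀ i, 0 ≤ p.2.1 i) ∧ ∀ i, 0 ≤ p.2.2 i := by
  have hm : MeasurableSet {p : Obs n | (∀ i, 0 ≤ p.2.1 i) ∧ ∀ i, 0 ≤ p.2.2 i} := by
    measurability
  rw [obsLaw, ae_map_iff (measurable_obsMap x).aemeasurable hm]
  refine Filter.Eventually.and ?_ ?_
  · refine ae_all_iff.2 fun i => ?_
    exact ((Measure.quasiMeasurePreserving_eval (fun _ : Fin n => lawT) i).comp
      (Measure.quasiMeasurePreserving_fst.comp Measure.quasiMeasurePreserving_fst)).ae hT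
  · refine ae_all_iff.2 fun i => ?_
    exact ((Measure.quasiMeasurePreserving_eval (fun _ : Fin n => lawE) i).comp
      (Measure.quasiMeasurePreserving_snd.comp Measure.quasiMeasurePreserving_fst)).ae hE

theorem measurableSet_typicalSet_fiber (P σ : ℝ) (lawE : Measure ℝ) (δ δ' δ'' : ℝ) {n : ℕ}
    (C : Finset (Fin n → ℝ)) (x : C) :
    MeasurableSet {z | (x, z) ∈ typicalSet P σ lawE δ δ' δ'' C} := by
  have h1 : MeasurableSet {p : Obs n | ∀ i, 0 ≤ p.2.1 i} := by measurability
  have h2 : MeasurableSet {p : Obs n | ∀ i, 0 ≤ p.2.2 i} := by measurability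
  have h3 : MeasurableSet {p : Obs n |
      (1 / (n : ℝ)) * ∑ i, p.1 i ^ 2 / (σ ^ 2 + p.2.2 i ^ 2 * P) - 1 ≤ δ} :=
    measurableSet_le (by fun_prop) measurable_const
  have h4 : MeasurableSet {p : Obs n |
      (n : ℝ) * σ ^ 2 * (1 - δ') ≤ ∑ i, (p.1 i - x.1 i * p.2.2 i) ^ 2} :=
    measurableSet_le measurable_const (by fun_prop)
  have h5 : MeasurableSet {p : Obs n |
      |(1 / (n : ℝ)) * ∑ i, Real.logb 2 (1 + p.2.2 i ^ 2 * (P / σ ^ 2))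
        - meanLogGain P σ lawE| ≤ δ''} := by
    refine measurableSet_le ?_ measurable_const
    have : Measurable fun p : Obs n => ∑ i, Real.logb 2 (1 + p.2.2 i ^ 2 * (P / σ ^ 2)) :=
      Finset.measurable_sum _ fun i _ => (measurable_logGain P σ).comp (by fun_prop)
    fun_prop
  exact h1.inter ((h2.inter h3).inter (h4.inter (h2.inter h5)))

theorem sum_sq_sub_le_zero {P : ℝ} {n : ℕ} {C : Finset (Fin n → ℝ)}
    (h : PowerConstrained P C) (hn : 1 ≤ n) {x : Fin n → ℝ} (hx : x ∈ C) :
    ∑ i, (x i ^ 2 - P) ≤ 0 := by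
  have h1 := h x hx
  have h2 : (0 : ℝ) < n := by exact_mod_cast hn
  rw [one_div, inv_mul_le_iff₀ h2] at h1
  simp only [Finset.sum_sub_distrib, Finset.sum_const, Finset.card_univ, Fintype.card_fin,
    nsmul_eq_mul]
  linarith

/-- Chernoff with parameter `-δ'/2` and the exact moment `(1+δ')^{-1/2}` of the normalised squared
noise. -/
theorem obsLaw_noise_le {σ : ℝ} (hσ : 0 < σ) (lawT lawE : Measure ℝ)
    [IsProbabilityMeasure lawT] [IsProbabilityMeasure lawE] {n : ℕ} {x : Fin n → ℝ} {δ' : ℝ} (hδ' : 0 < δ') :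
    (obsLaw σ lawT lawE x).real
      {p | ∑ i, (p.1 i - x i * p.2.2 i) ^ 2 < (n : ℝ) * σ ^ 2 * (1 - δ')}
      ≤ Real.exp (-((n : ℝ) / 4 * δ' ^ 2)) := by
  have hint : ∫⁻ q, ENNReal.ofReal (Real.exp (-(δ' / 2) * (q.2 ^ 2 / σ ^ 2)))
      ∂(letterLaw σ lawE) ≤ ENNReal.ofReal (Real.exp (-(δ' / 2) + δ' ^ 2 / 4)) := by
    rw [lintegral_prod _ (by fun_prop)]
    simp only [lintegral_exp_sq_gaussianReal hσ (show -(δ' / 2) < 1 / 2 by linarith),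
      lintegral_const, measure_univ, mul_one]
    refine ENNReal.ofReal_le_ofReal ?_
    rw [← Real.sqrt_inv]
    refine Real.sqrt_le_iff.2 ⟨(Real.exp_pos _).le, ?_⟩
    have h1 := Real.le_log_one_add_of_nonneg hδ'.le
    -- The right-hand side is a lower bound for `log(1+δ')`.
    have h2 : δ' - δ' ^ 2 / 2 ≤ 2 * δ' / (δ' + 2) := by
      rw [le_div_iff₀ (by positivity)]
      nlinarith [pow_pos hδ' 3]
    have h3 : (1 - 2 * -(δ' / 2))⁻¹ = Real.exp (-Real.log (1 + δ')) := by
      rw [Real.exp_neg, Real.exp_log (by positivity)]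
      congr 1
      ring
    rw [h3, ← Real.exp_nat_mul]
    refine Real.exp_le_exp.2 ?_
    push_cast
    linarith
  have h1 := obsLaw_le_sum_le σ lawT lawE x
    (F := fun _ q => -(δ' / 2) * (q.2 ^ 2 / σ ^ 2)) (fun i => by fun_prop)
    (fun _ => hint) (-(δ' / 2) * (n * (1 - δ')))
  refine le_trans (measureReal_mono ?_) (h1.trans (Real.exp_le_exp.2 ?_))
  · intro p hp
    simp only [Set.mem_ofPred_eq, ← Finset.mul_sum, ← Finset.sum_div] at hp ⊢
    refine mul_le_mul_of_nonpos_left ?_ (by linarith)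
    rw [div_le_iff₀ (by positivity)]
    simp only [mul_comm (p.2.2 _)]
    linarith
  · simp only [Finset.sum_const, Finset.card_univ, Fintype.card_fin, nsmul_eq_mul]
    apply le_of_eq
    ring

variable {P σ : ℝ} (hP : 0 < P) (hσ : 0 < σ) (lawT lawE : Measure ℝ) [IsProbabilityMeasure lawT]
  [IsProbabilityMeasure lawE] {n : ℕ} {x : Fin n → ℝ} {γ K : ℝ}

include hP hσ

theorem obsLaw_outPower_le (hn : 1 ≤ n) (hx : ∑ i, (x i ^ 2 - P) ≤ 0) (hγ : 0 < γ)
    (hγ' : γ < 1 / 2) (hK : 0 < K)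
    (htail : ∀ i, tailConst (letterLaw σ lawE) γ (outPower P σ (x i)) ≤ K) {δ : ℝ} (hδ : 0 < δ)
    (hδK : 2 * (δ / K) ≤ γ) :
    (obsLaw σ lawT lawE x).real
      {p | δ < (1 / (n : ℝ)) * ∑ i, p.1 i ^ 2 / (σ ^ 2 + p.2.2 i ^ 2 * P) - 1}
      ≤ Real.exp (-((n : ℝ) * (1 / (4 * K)) * δ ^ 2)) := by
  have hn0 : (0 : ℝ) < n := by exact_mod_cast hn
  -- Minimises `s²K/2 - sδ`; the value `-δ²/(2K)` is twice the exponent needed.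
  set s := δ / K with hs
  have hs0 : 0 < s := by positivity
  have h1 := obsLaw_le_sum_le σ lawT lawE x
    (F := fun i q => s * outPower P σ (x i) q) (fun i => (measurable_outPower P σ (x i)).const_mul s)
    (fun i => lintegral_exp_mul_le_of_tailConst_le (measurable_outPower P σ (x i))
      (outPower_nonneg hP hσ (x i)) hγ (integrable_exp_outPower hP hσ lawE hγ hγ' (x i))
      (s := s) (by rwa [abs_of_pos hs0]) (htail i)) (s * (n * (1 + δ)))
  refine le_trans (measureReal_mono ?_) (h1.trans (Real.exp_le_exp.2 ?_))
  · intro p hp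
    simp only [Set.mem_ofPred_eq, outPower, add_sub_cancel, ← Finset.mul_sum] at hp ⊢
    refine mul_le_mul_of_nonneg_left ?_ hs0.le
    rw [lt_sub_iff_add_lt, one_div, lt_inv_mul_iff₀ hn0] at hp
    linarith
  · simp only [integral_outPower hP hσ lawE, Finset.sum_add_distrib, ← Finset.mul_sum,
      Finset.sum_const, Finset.card_univ, Fintype.card_fin, nsmul_eq_mul, mul_one]
    have h2 : powerSlope P σ lawE * ∑ i, (x i ^ 2 - P) ≤ 0 :=
      mul_nonpos_of_nonneg_of_nonpos (powerSlope_nonneg hP hσ lawE) hx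
    have h3 : s ^ 2 * (K / 2) = 1 / (2 * K) * δ ^ 2 := by
      rw [hs]
      field_simp
    have h4 : s * δ = 1 / K * δ ^ 2 := by
      rw [hs]
      field_simp
    have h5 := mul_nonpos_of_nonneg_of_nonpos hs0.le h2
    have h6 : s * (n * (1 + δ)) = s * n + n * (s * δ) := by ring
    have h7 : 0 ≤ n * (1 / (4 * K)) * δ ^ 2 := by positivity
    have h8 : n * (1 / (2 * K) * δ ^ 2) - n * (1 / K * δ ^ 2)
        = -(2 * (n * (1 / (4 * K)) * δ ^ 2)) := by
      field_simp
      ring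
    rw [mul_left_comm, h3, h6, h4]
    linarith

theorem obsLaw_logGain_le (hE : Integrable (fun h : ℝ => h ^ 2) lawE) (hn : 1 ≤ n) (hγ : 0 < γ)
    (hγ' : γ < 1 / 2) (hK : 0 < K) (htail : tailConst lawE γ (logGain P σ) ≤ K) {δ : ℝ}
    (hδ : 0 < δ) (hδK : 2 * (δ / K) ≤ γ) :
    (obsLaw σ lawT lawE x).real
      {p | δ < |(1 / (n : ℝ)) * ∑ i, logGain P σ (p.2.2 i) - meanLogGain P σ lawE|}
      ≤ 2 * Real.exp (-((n : ℝ) * (1 / (4 * K)) * δ ^ 2)) := by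
  have hn0 : (0 : ℝ) < n := by exact_mod_cast hn
  -- One tail for each sign of `s`.
  have hside : ∀ s : ℝ, |s| = δ / K → (obsLaw σ lawT lawE x).real
      {p | n * (s * meanLogGain P σ lawE) + n * (|s| * δ)
        ≤ ∑ i, s * logGain P σ (p.2.2 i)}
      ≤ Real.exp (-((n : ℝ) * (1 / (4 * K)) * δ ^ 2)) := by
    intro s hs
    have hm : Measurable fun h => s * logGain P σ h := (measurable_logGain P σ).const_mul s
    have h1 := obsLaw_le_sum_le σ lawT lawE x
      (F := fun _ q => s * logGain P σ q.1) (fun i => hm.comp measurable_fst)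
      (fun _ => by
        rw [lintegral_letterLaw_fst σ lawE
          (f := fun h => ENNReal.ofReal (Real.exp (s * logGain P σ h)))
          (Real.measurable_exp.comp hm).ennreal_ofReal]
        exact lintegral_exp_mul_le_of_tailConst_le (measurable_logGain P σ)
          (logGain_nonneg hP hσ) hγ
          (integrable_exp_logGain hP hσ lawE hE (by linarith [half_lt_log_two]))
          (s := s) (by rwa [hs]) htail) (n * (s * meanLogGain P σ lawE) + n * (|s| * δ))
    refine h1.trans (Real.exp_le_exp.2 ?_)
    simp only [Finset.sum_const, Finset.card_univ, Fintype.card_fin, nsmul_eq_mul]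
    have h2 : ∫ h, logGain P σ h ∂lawE = meanLogGain P σ lawE := rfl
    have h3 : s ^ 2 * (K / 2) = 1 / (2 * K) * δ ^ 2 := by
      rw [← sq_abs, hs]
      field_simp
    have h4 : |s| * δ = 1 / K * δ ^ 2 := by
      rw [hs]
      field_simp
    have h7 : 0 ≤ n * (1 / (4 * K)) * δ ^ 2 := by positivity
    have h8 : n * (1 / (2 * K) * δ ^ 2) - n * (1 / K * δ ^ 2)
        = -(2 * (n * (1 / (4 * K)) * δ ^ 2)) := by
      field_simp
      ring
    rw [h2, h3, h4]
    linarith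
  have hs0 : 0 < δ / K := by positivity
  have h1 := hside (δ / K) (abs_of_pos hs0)
  have h2 := hside (-(δ / K)) (by rw [abs_neg, abs_of_pos hs0])
  rw [two_mul]
  refine le_trans (measureReal_mono ?_) ((measureReal_union_le _ _).trans (add_le_add h1 h2))
  intro p hp
  simp only [Set.mem_ofPred_eq, Set.mem_union, ← Finset.mul_sum, abs_neg, abs_of_pos hs0]
    at hp ⊢
  rcases lt_abs.1 hp with h | h
  · left
    rw [lt_sub_iff_add_lt, one_div, lt_inv_mul_iff₀ hn0] at h
    nlinarith
  · right
    rw [neg_sub, lt_sub_comm, one_div, inv_mul_lt_iff₀ hn0] at h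
    nlinarith

theorem isTypical_typicalSet (hT0 : ∀ᵐ h ∂lawT, 0 ≤ h) (hE0 : ∀ᵐ h ∂lawE, 0 ≤ h)
    (hE : Integrable (fun h : ℝ => h ^ 2) lawE) (hγ : 0 < γ) (hγ' : γ < 1 / 2)
    {C : Finset (Fin n → ℝ)} {δ δ' δ'' : ℝ} (hn : 1 ≤ n) (hC : PowerConstrained P C)
    (hK : IsTailBound P σ lawE γ C K) (hδ : 0 < δ)
    (hδ0 : δ ≤ γ * (1 - powerSlope P σ lawE * P) ^ 2) (hδ' : 0 < δ') (hδ'' : 0 < δ'')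
    (hδ''0 : δ'' ≤ γ * (1 - powerSlope P σ lawE * P) ^ 2) :
    IsTypical (eveChannel σ lawT lawE C) (eps K n δ δ' δ'')
      (typicalSet P σ lawE δ δ' δ'' C) := by
  refine ⟨measurableSet_typicalSet_fiber P σ lawE δ δ' δ'' C, fun x => ?_⟩
  set v := 1 - powerSlope P σ lawE * P with hv
  have hv0 : 0 < v := sub_pos.2 (powerSlope_mul_lt_one hP hσ lawE)
  have htail : ∀ i, tailConst (letterLaw σ lawE) γ (outPower P σ (x.1 i)) ≤ K :=
    fun i => hK.1 x.1 x.2 i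
  -- The mean output power is at least `v = 1 - κP` for every symbol, so any one coordinate,
  -- available since `1 ≤ n`, bounds `K` from below.
  have hKv : 2 * v ^ 2 ≤ K := by
    refine le_trans ?_ (htail ⟨0, hn⟩)
    refine le_trans ?_ (two_mul_sq_integral_le_tailConst (measurable_outPower P σ _)
      (outPower_nonneg hP hσ _) hγ (integrable_exp_outPower hP hσ lawE hγ hγ' _))
    rw [integral_outPower hP hσ lawE]
    have : v ≤ 1 + powerSlope P σ lawE * (x.1 ⟨0, hn⟩ ^ 2 - P) := by
      have := mul_nonneg (powerSlope_nonneg hP hσ lawE) (sq_nonneg (x.1 ⟨0, hn⟩))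
      rw [hv]
      linarith
    gcongr
  have hK0 : 0 < K := lt_of_lt_of_le (by positivity) hKv
  have hdK : ∀ d, d ≤ γ * v ^ 2 → 2 * (d / K) ≤ γ := fun d hd => by
    rw [← mul_div_assoc, div_le_iff₀ hK0]
    have := mul_le_mul_of_nonneg_left hKv hγ.le
    linarith
  have hA := obsLaw_outPower_le hP hσ lawT lawE hn (sum_sq_sub_le_zero hC hn x.2) hγ hγ' hK0 htail hδ
    (hdK δ hδ0)
  have hB := obsLaw_noise_le hσ lawT lawE (x := x.1) hδ'
  have hG := obsLaw_logGain_le hP hσ lawT lawE (x := x.1) hE hn hγ hγ' hK0 hK.2 hδ''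
    (hdK δ'' hδ''0)
  have hN : (obsLaw σ lawT lawE x.1).real
      {p | (∀ i, 0 ≤ p.2.1 i) ∧ ∀ i, 0 ≤ p.2.2 i}ᶜ = 0 := by
    rw [measureReal_def, mem_ae_iff.1 (ae_obsLaw_nonneg σ lawT lawE hT0 hE0 x.1)]
    rfl
  have hU := (measureReal_union_le _ _).trans (add_le_add ((measureReal_union_le _ _).trans
    (add_le_add ((measureReal_union_le _ _).trans (add_le_add hA hB)) hG)) hN.le)
  have hcompl : (obsLaw σ lawT lawE x.1).real
      {z | (x, z) ∈ typicalSet P σ lawE δ δ' δ'' C}ᶜ ≤ eps K n δ δ' δ'' := by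
    refine le_trans (measureReal_mono fun p hp => ?_) (hU.trans ?_)
    · by_contra hcon
      simp only [Set.mem_union, Set.mem_ofPred_eq, Set.mem_compl_iff, not_or, not_lt,
        not_not] at hcon
      obtain ⟨⟨⟨h1, h2⟩, h3⟩, h4, h5⟩ := hcon
      exact hp ⟨h4, ⟨h5, h1⟩, h2, ⟨h5, h3⟩⟩
    -- The output power condition is one-sided, so one of its two exponentials in `eps` is spare.
    · rw [eps]
      have := Real.exp_pos (-((n : ℝ) * (1 / (4 * K)) * δ ^ 2))
      linarith
  rw [probReal_compl_eq_one_sub (measurableSet_typicalSet_fiber P σ lawE δ δ' δ'' C x)] at hcompl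
  simp only [eveChannel]
  linarith

end Typical

/-! ### Log-densities and the single-letter loss. -/

theorem log_gaussianPDFReal (m z : ℝ) {v : ℝ} (hv : 0 < v) :
    Real.log (gaussianPDFReal m (Real.toNNReal v) z)
      = -(1 / 2) * Real.log (2 * Real.pi * v) - (z - m) ^ 2 / (2 * v) := by
  rw [gaussianPDFReal, Real.coe_toNNReal _ hv.le, Real.log_mul (by positivity)
    (Real.exp_pos _).ne', Real.log_exp, Real.log_inv, Real.log_sqrt (by positivity)]
  ring

theorem gaussianPDFReal_toNNReal_pos (m z : ℝ) {v : ℝ} (hv : 0 < v) :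
    0 < gaussianPDFReal m (Real.toNNReal v) z :=
  gaussianPDFReal_pos _ _ _ (by simpa using hv)

theorem log_two_mul_logGain (P σ h : ℝ) :
    Real.log 2 * logGain P σ h = Real.log (1 + h ^ 2 * (P / σ ^ 2)) := by
  have := half_lt_log_two
  rw [logGain, Real.logb]
  field_simp

theorem log_variance {P σ : ℝ} (hP : 0 < P) (hσ : 0 < σ) (h : ℝ) :
    Real.log (2 * Real.pi * (σ ^ 2 + h ^ 2 * P))
      = Real.log (2 * Real.pi * σ ^ 2) + Real.log 2 * logGain P σ h := by
  rw [log_two_mul_logGain, ← Real.log_mul (by positivity) (by positivity)]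
  congr 1
  field_simp

theorem lintegral_obsRef_prod_le (lawT lawE : Measure ℝ) [IsProbabilityMeasure lawT]
    [IsProbabilityMeasure lawE] {n : ℕ} {G : ℝ × ℝ → ℝ≥0∞} (hG : Measurable G) {c : ℝ≥0∞}
    (hc : ∀ h, ∫⁻ z, G (h, z) ≤ c) :
    ∫⁻ p, ∏ i, G (p.2.2 i, p.1 i) ∂(obsRef lawT lawE n) ≤ c ^ n := by
  have hm : Measurable fun p : Obs n => ∏ i, G (p.2.2 i, p.1 i) :=
    Finset.measurable_prod _ fun i _ => hG.comp (by fun_prop)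
  rw [lintegral_prod_symm _ hm.aemeasurable]
  have h1 : ∀ a : (Fin n → ℝ) × (Fin n → ℝ), ∫⁻ z : Fin n → ℝ, ∏ i, G (a.2 i, z i) ≤ c ^ n := by
    intro a
    rw [volume_pi, lintegral_pi_prod_eq_prod _ (f := fun i z => G (a.2 i, z))
      fun i => hG.comp measurable_prodMk_left]
    refine (Finset.prod_le_prod' fun i _ => hc (a.2 i)).trans ?_
    simp
  refine (lintegral_mono h1).trans ?_
  simp

instance sigmaFinite_obsRef (lawT lawE : Measure ℝ) [IsProbabilityMeasure lawT]
    [IsProbabilityMeasure lawE] (n : ℕ) : SigmaFinite (obsRef lawT lawE n) :=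
  Measure.prod.instSigmaFinite

theorem measurable_gaussianPDFReal_output (P σ c : ℝ) :
    Measurable fun q : ℝ × ℝ =>
      gaussianPDFReal 0 (Real.toNNReal (c * (σ ^ 2 + q.1 ^ 2 * P))) q.2 := by
  have h : Measurable fun q : ℝ × ℝ =>
      ((0 : ℝ), Real.toNNReal (c * (σ ^ 2 + q.1 ^ 2 * P)), q.2) := by fun_prop
  exact measurable_uncurry_gaussianPDFReal.comp h

/-- The real-valued log-likelihood ratio of the output for the symbol `x` and a heavy-tailed
perturbation of the Gaussian output density, as a function of coefficient and noise. -/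
noncomputable def letterLoss (P σ ρ x : ℝ) (q : ℝ × ℝ) : ℝ :=
  Real.log (gaussianPDFReal 0 (Real.toNNReal (σ ^ 2)) q.2) -
    Real.log (gaussianPDFReal 0 (Real.toNNReal (σ ^ 2 + q.1 ^ 2 * P)) (q.1 * x + q.2)
      + ρ * (1 + (q.1 * x + q.2) ^ 2)⁻¹)

theorem measurable_letterLoss (P σ ρ x : ℝ) : Measurable (letterLoss P σ ρ x) := by
  have h1 : Measurable fun q : ℝ × ℝ =>
      gaussianPDFReal 0 (Real.toNNReal (σ ^ 2 + q.1 ^ 2 * P)) (q.1 * x + q.2) := by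
    have := (measurable_gaussianPDFReal_output P σ 1).comp
      (show Measurable fun q : ℝ × ℝ => (q.1, q.1 * x + q.2) by fun_prop)
    simpa [Function.comp_def] using this
  have h2 : Measurable fun q : ℝ × ℝ => gaussianPDFReal 0 (Real.toNNReal (σ ^ 2)) q.2 :=
    (measurable_gaussianPDFReal _ _).comp measurable_snd
  unfold letterLoss
  fun_prop

/-- Keeps only the heavy-tailed summand of the auxiliary density, which gives logarithmic growth in
`x`. -/
theorem letterLoss_le_tail {P σ : ℝ} (hσ : 0 < σ) {ρ : ℝ} (hρ : 0 < ρ) (x : ℝ) (q : ℝ × ℝ) :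
    letterLoss P σ ρ x q ≤ (-(1 / 2) * Real.log (2 * Real.pi * σ ^ 2) - Real.log ρ)
      + Real.log (1 + x ^ 2) + Real.log ((1 + 2 * q.1 ^ 2) * (1 + 2 * q.2 ^ 2)) := by
  have hg := gaussianPDFReal_nonneg 0 (Real.toNNReal (σ ^ 2 + q.1 ^ 2 * P)) (q.1 * x + q.2)
  have h1 : Real.log (ρ * (1 + (q.1 * x + q.2) ^ 2)⁻¹)
      ≤ Real.log (gaussianPDFReal 0 (Real.toNNReal (σ ^ 2 + q.1 ^ 2 * P)) (q.1 * x + q.2)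
        + ρ * (1 + (q.1 * x + q.2) ^ 2)⁻¹) :=
    Real.log_le_log (by positivity) (by linarith)
  rw [Real.log_mul hρ.ne' (by positivity), Real.log_inv] at h1
  rw [letterLoss, log_gaussianPDFReal _ _ (by positivity : 0 < σ ^ 2), sub_zero]
  have h2 : Real.log (1 + (q.1 * x + q.2) ^ 2)
      ≤ Real.log (1 + x ^ 2) + Real.log ((1 + 2 * q.1 ^ 2) * (1 + 2 * q.2 ^ 2)) := by
    rw [← Real.log_mul (by positivity) (by positivity)]
    refine Real.log_le_log (by positivity) ?_
    have h3 : 1 + (q.1 * x + q.2) ^ 2 ≤ 1 + 2 * (q.1 * x) ^ 2 + 2 * q.2 ^ 2 := by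
      nlinarith [sq_nonneg (q.1 * x - q.2)]
    have h4 : 1 + 2 * (q.1 * x) ^ 2 ≤ (1 + x ^ 2) * (1 + 2 * q.1 ^ 2) := by
      nlinarith [sq_nonneg x, sq_nonneg q.1]
    have h5 : 1 ≤ (1 + x ^ 2) * (1 + 2 * q.1 ^ 2) := by nlinarith [sq_nonneg (q.1 * x)]
    nlinarith [mul_le_mul_of_nonneg_right h5 (by positivity : 0 ≤ 2 * q.2 ^ 2)]
  have h3 : 0 ≤ q.2 ^ 2 / (2 * σ ^ 2) := by positivity
  linarith

/-! ### Max-information on `T_n`; the Gaussian bound for the loss. -/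

section Bounds

variable {P σ : ℝ} (hP : 0 < P) (hσ : 0 < σ) (lawT lawE : Measure ℝ) [IsProbabilityMeasure lawT]
  [IsProbabilityMeasure lawE] {n : ℕ}

include hP hσ

theorem maxInfoOn_typicalSet_le (hn : 1 ≤ n) {C : Finset (Fin n → ℝ)} (hC : C.Nonempty)
    {δ δ' δ'' : ℝ} (hδ : 0 < δ) :
    maxInfoOn (eveChannel σ lawT lawE C) (typicalSet P σ lawE δ δ' δ'' C)
      ≤ (((n * (1 / 2 * Real.log (1 + δ) + δ' / 2
          + Real.log 2 / 2 * (meanLogGain P σ lawE + δ''))) / Real.log 2 : ℝ) : EReal) := by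
  have : Nonempty C := hC.to_subtype
  have hn0 : (0 : ℝ) < n := by exact_mod_cast hn
  set r := n * (1 / 2 * Real.log (1 + δ) + δ' / 2
    + Real.log 2 / 2 * (meanLogGain P σ lawE + δ'')) with hr
  set g : ℝ × ℝ → ℝ := fun q =>
    gaussianPDFReal 0 (Real.toNNReal ((1 + δ) * (σ ^ 2 + q.1 ^ 2 * P))) q.2 with hg
  have hgm : Measurable g := measurable_gaussianPDFReal_output P σ (1 + δ)
  have hv : ∀ h : ℝ, 0 < (1 + δ) * (σ ^ 2 + h ^ 2 * P) := fun h =>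
    mul_pos (by linarith) (variance_pos hP hσ h)
  have hgpos : ∀ q, 0 < g q := fun q => gaussianPDFReal_toNNReal_pos _ _ (hv _)
  have hpm : Measurable fun p : Obs n => ∏ i, ENNReal.ofReal (g (p.2.2 i, p.1 i)) :=
    Finset.measurable_prod _ fun i _ => (hgm.comp (by fun_prop)).ennreal_ofReal
  refine maxInfoOn_le_of_density_le (ν := obsRef lawT lawE n)
    (f := fun x : C => obsDensity σ x.1)
    (g := fun p => ENNReal.ofReal (Real.exp r) * ∏ i, ENNReal.ofReal (g (p.2.2 i, p.1 i)))
    (fun x => measurable_obsDensity σ x.1)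
    (fun x => obsLaw_eq_withDensity hσ lawT lawE x.1)
    (measurableSet_typicalSet_fiber P σ lawE δ δ' δ'' C) ?_ ?_ ?_
  · exact hpm.const_mul _
  · intro x p hp
    obtain ⟨-, ⟨-, h1⟩, h2, -, h3⟩ := hp
    simp only [obsDensity, gaussianPDF]
    rw [← ENNReal.ofReal_prod_of_nonneg fun i _ => gaussianPDFReal_nonneg _ _ _,
      ← ENNReal.ofReal_prod_of_nonneg fun i _ => (hgpos _).le,
      ← ENNReal.ofReal_mul (Real.exp_pos r).le]
    refine ENNReal.ofReal_le_ofReal ?_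
    have hwpos : ∀ i, 0 < gaussianPDFReal (p.2.2 i * x.1 i) (Real.toNNReal (σ ^ 2)) (p.1 i) :=
      fun i => gaussianPDFReal_toNNReal_pos _ _ (by positivity)
    have hw0 := Finset.prod_pos fun i (_ : i ∈ Finset.univ) => hwpos i
    have hg0 := Finset.prod_pos fun i (_ : i ∈ Finset.univ) => hgpos (p.2.2 i, p.1 i)
    rw [← Real.log_le_log_iff hw0 (mul_pos (Real.exp_pos r) hg0),
      Real.log_mul (Real.exp_pos r).ne' hg0.ne', Real.log_exp,
      Real.log_prod fun i _ => (hwpos i).ne', Real.log_prod fun i _ => (hgpos _).ne']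
    have hlw : ∀ i, Real.log (gaussianPDFReal (p.2.2 i * x.1 i) (Real.toNNReal (σ ^ 2)) (p.1 i))
        = -(1 / 2) * Real.log (2 * Real.pi * σ ^ 2)
          - (p.1 i - x.1 i * p.2.2 i) ^ 2 / (2 * σ ^ 2) := fun i => by
      rw [log_gaussianPDFReal _ _ (by positivity), mul_comm (x.1 i)]
    have hlg : ∀ i, Real.log (g (p.2.2 i, p.1 i))
        = -(1 / 2) * Real.log (2 * Real.pi * σ ^ 2) - 1 / 2 * Real.log (1 + δ)
          - Real.log 2 / 2 * logGain P σ (p.2.2 i)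
          - (1 / (2 * (1 + δ))) * (p.1 i ^ 2 / (σ ^ 2 + p.2.2 i ^ 2 * P)) := fun i => by
      have hpi := Real.pi_pos
      have hv' := variance_pos hP hσ (p.2.2 i)
      have h4 : 2 * Real.pi * ((1 + δ) * (σ ^ 2 + p.2.2 i ^ 2 * P))
          = (1 + δ) * (2 * Real.pi * (σ ^ 2 + p.2.2 i ^ 2 * P)) := by ring
      rw [hg, log_gaussianPDFReal _ _ (hv _), h4, Real.log_mul (by positivity) (by positivity),
        log_variance hP hσ, sub_zero]
      have h5 : p.1 i ^ 2 / (2 * ((1 + δ) * (σ ^ 2 + p.2.2 i ^ 2 * P)))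
          = (1 / (2 * (1 + δ))) * (p.1 i ^ 2 / (σ ^ 2 + p.2.2 i ^ 2 * P)) := by
        rw [div_mul_div_comm, one_mul, mul_assoc]
      rw [h5]
      ring
    simp only [hlw, hlg, Finset.sum_sub_distrib, ← Finset.mul_sum, ← Finset.sum_div,
      Finset.sum_const, Finset.card_univ, Fintype.card_fin, nsmul_eq_mul]
    have k1 : ∑ i, p.1 i ^ 2 / (σ ^ 2 + p.2.2 i ^ 2 * P) ≤ n * (1 + δ) := by
      rw [sub_le_iff_le_add, one_div, inv_mul_le_iff₀ hn0] at h1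
      linarith
    -- The inflated variance absorbs the excess output power; its only cost is `log(1+δ)/2` per
    -- letter.
    have k1' : 1 / (2 * (1 + δ)) * ∑ i, p.1 i ^ 2 / (σ ^ 2 + p.2.2 i ^ 2 * P) ≤ n / 2 := by
      rw [one_div_mul_eq_div, div_le_div_iff₀ (by positivity) two_pos]
      linarith
    have k2 : n * (1 - δ') / 2 ≤ (∑ i, (p.1 i - x.1 i * p.2.2 i) ^ 2) / (2 * σ ^ 2) := by
      rw [div_le_div_iff₀ two_pos (by positivity)]
      have h2' : (n : ℝ) * σ ^ 2 * (1 - δ') ≤ ∑ i, (p.1 i - x.1 i * p.2.2 i) ^ 2 := h2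
      nlinarith
    have k3 : ∑ i, logGain P σ (p.2.2 i) ≤ n * (meanLogGain P σ lawE + δ'') := by
      have h3' := (abs_le.1 h3).2
      rw [sub_le_iff_le_add, one_div, inv_mul_le_iff₀ hn0] at h3'
      have : ∑ i, logGain P σ (p.2.2 i) ≤ n * (δ'' + meanLogGain P σ lawE) := h3'
      linarith
    have k3' := mul_le_mul_of_nonneg_left k3 (by linarith [half_lt_log_two] : 0 ≤ Real.log 2 / 2)
    rw [hr]
    nlinarith
  · rw [lintegral_const_mul _ hpm]
    have := lintegral_obsRef_prod_le lawT lawE (n := n) hgm.ennreal_ofReal (c := 1) fun h =>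
      (lintegral_gaussianPDFReal_eq_one 0 (v := Real.toNNReal ((1 + δ) * (σ ^ 2 + h ^ 2 * P)))
        (by simpa using hv h)).le
    calc _ ≤ ENNReal.ofReal (Real.exp r) * 1 ^ n := by gcongr
      _ = _ := by simp

/-- Keeps only the Gaussian summand. The bound is free of `ρ`, and its mean is affine in `x²`. -/
theorem letterLoss_le_gaussian {ρ : ℝ} (hρ : 0 < ρ) (x : ℝ) (q : ℝ × ℝ) :
    letterLoss P σ ρ x q ≤ Real.log 2 / 2 * logGain P σ q.1 + 1 / 2 * outPower P σ x q
      - q.2 ^ 2 / (2 * σ ^ 2) := by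
  have hv := variance_pos hP hσ q.1
  have hg := gaussianPDFReal_toNNReal_pos 0 (q.1 * x + q.2) hv
  have h1 : Real.log (gaussianPDFReal 0 (Real.toNNReal (σ ^ 2 + q.1 ^ 2 * P)) (q.1 * x + q.2))
      ≤ Real.log (gaussianPDFReal 0 (Real.toNNReal (σ ^ 2 + q.1 ^ 2 * P)) (q.1 * x + q.2)
        + ρ * (1 + (q.1 * x + q.2) ^ 2)⁻¹) := by
    refine Real.log_le_log hg ?_
    have : 0 ≤ ρ * (1 + (q.1 * x + q.2) ^ 2)⁻¹ := by positivity
    linarith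
  rw [log_gaussianPDFReal _ _ hv, log_variance hP hσ, sub_zero] at h1
  rw [letterLoss, log_gaussianPDFReal _ _ (by positivity : 0 < σ ^ 2), sub_zero]
  have h2 : (q.1 * x + q.2) ^ 2 / (2 * (σ ^ 2 + q.1 ^ 2 * P)) = 1 / 2 * outPower P σ x q := by
    rw [outPower]
    field_simp
  rw [h2] at h1
  linarith

end Bounds

/-! ### Exponential moments of the loss, uniformly in the symbol. -/

section SingleLetter

variable {P σ : ℝ} (hP : 0 < P) (hσ : 0 < σ) (lawT lawE : Measure ℝ) [IsProbabilityMeasure lawT]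
  [IsProbabilityMeasure lawE] {n : ℕ}

include hP hσ

omit [IsProbabilityMeasure lawE] in
theorem capE_nonneg : 0 ≤ capE P σ lawE := by
  have : 0 ≤ meanLogGain P σ lawE := integral_nonneg fun h => logGain_nonneg hP hσ h
  rw [capE]
  positivity

/-- For symbols of bounded power, exponential moments of small order of the loss are governed by
its mean, uniformly in the symbol. -/
theorem exists_lintegral_exp_letterLoss_le_of_sq_le (hE : Integrable (fun h : ℝ => h ^ 2) lawE)
    {η : ℝ} (hη : 0 < η) (A : ℝ) :
    ∃ s : ℝ, 0 < s ∧ s ≤ 1 ∧ ∀ ρ x : ℝ, 0 < ρ → x ^ 2 ≤ A →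
      ∫⁻ q, ENNReal.ofReal (Real.exp (s * letterLoss P σ ρ x q)) ∂(letterLaw σ lawE)
        ≤ ENNReal.ofReal (Real.exp (s * (Real.log 2 * capE P σ lawE
          + 1 / 2 * powerSlope P σ lawE * (x ^ 2 - P) + η))) := by
  have hl2 := half_lt_log_two
  by_cases hA : A < 0
  · exact ⟨1, one_pos, le_rfl, fun ρ x _ hx => absurd (hx.trans_lt hA) (sq_nonneg x).not_gt⟩
  push Not at hA
  -- A common majorant of `|V|` over all symbols with `x² ≤ A`, from `outPower_le` with `θ = 1`. At
  -- order `1/6` its noise part has coefficient `1/4 < 1/2`.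
  set Y : ℝ × ℝ → ℝ := fun q =>
    Real.log 2 / 2 * logGain P σ q.1 + A / P + 3 / 2 * (q.2 ^ 2 / σ ^ 2) with hY
  have hlm := measurable_logGain P σ
  have hYm : Measurable Y := by fun_prop
  have hY0 : ∀ q, 0 ≤ Y q := fun q => by
    have := logGain_nonneg hP hσ q.1
    positivity
  have hYi : Integrable (fun q => Real.exp (1 / 6 * Y q)) (letterLaw σ lawE) := by
    have h1 := integrable_exp_logGain hP hσ lawE hE
      (show Real.log 2 / 12 ≤ Real.log 2 by linarith)
    have h2 := integrable_exp_sq_gaussianReal hσ (show (1 / 4 : ℝ) < 1 / 2 by norm_num)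
    refine ((h1.mul_prod h2).const_mul (Real.exp (A / P / 6))).congr
      (Eventually.of_forall fun q => ?_)
    simp only [hY]
    rw [← Real.exp_add, ← Real.exp_add]
    congr 1
    ring
  set D := ∫ q, Y q ^ 2 * Real.exp (1 / 12 * Y q) ∂(letterLaw σ lawE) with hD
  have hDi := integrable_pow_mul_exp hYm hY0 hYi (show (1 / 12 : ℝ) < 1 / 6 by norm_num) 2
  have hD0 : 0 ≤ D := integral_nonneg fun q => by positivity
  have hYint := integrable_of_exp hYm hY0 (by norm_num) hYi
  -- The second-order term `s²D` of the moment bound must cost at most `sη`.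
  refine ⟨min (1 / 12) (η / (D + 1)), by positivity, (min_le_left _ _).trans (by norm_num), ?_⟩
  set s := min (1 / 12) (η / (D + 1)) with hs
  have hs0 : 0 < s := by positivity
  have hs1 : s ≤ 1 / 12 := min_le_left _ _
  have hsD : s * D ≤ η := by
    have h1 : s * (D + 1) ≤ η := (le_div_iff₀ (by positivity)).1 (min_le_right _ _)
    nlinarith
  intro ρ x hρ hx
  set V : ℝ × ℝ → ℝ := fun q => Real.log 2 / 2 * logGain P σ q.1 + 1 / 2 * outPower P σ x q
    - q.2 ^ 2 / (2 * σ ^ 2) with hV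
  have hom := measurable_outPower P σ x
  have hVm : Measurable V := by fun_prop
  have hVY : ∀ q, |V q| ≤ Y q := fun q => by
    have h1 := outPower_le hP hσ one_pos x q
    have h2 := outPower_nonneg hP hσ x q
    have h3 := mul_nonneg (by linarith : 0 ≤ Real.log 2 / 2) (logGain_nonneg hP hσ q.1)
    have h4 : x ^ 2 / P ≤ A / P := by gcongr
    have h5 : 0 ≤ A / P := by positivity
    have h6 : 0 ≤ q.2 ^ 2 / σ ^ 2 := by positivity
    have h7 : q.2 ^ 2 / (2 * σ ^ 2) = 1 / 2 * (q.2 ^ 2 / σ ^ 2) := by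
      field_simp
    simp only [hV, hY]
    rw [h7, abs_le]
    constructor <;> linarith
  have hVi : Integrable V (letterLaw σ lawE) :=
    hYint.mono' hVm.aestronglyMeasurable (Eventually.of_forall fun q => hVY q)
  have hle : ∀ q, V q ^ 2 * Real.exp (|s| * |V q|) ≤ Y q ^ 2 * Real.exp (1 / 12 * Y q) :=
    fun q => by
      have h1 : V q ^ 2 ≤ Y q ^ 2 := sq_le_sq' (by linarith [abs_le.1 (hVY q)])
        ((le_abs_self _).trans (hVY q))
      rw [abs_of_pos hs0]
      have h2 : s * |V q| ≤ 1 / 12 * Y q := mul_le_mul hs1 (hVY q) (abs_nonneg _) (by norm_num)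
      gcongr
  have hV2i : Integrable (fun q => V q ^ 2 * Real.exp (|s| * |V q|)) (letterLaw σ lawE) := by
    refine hDi.mono' (by fun_prop) (Eventually.of_forall fun q => ?_)
    rw [Real.norm_of_nonneg (by positivity)]
    exact hle q
  have hmain := lintegral_exp_mul_le (letterLaw σ lawE) hVi hV2i (integral_mono hV2i hDi hle)
  have hEV : ∫ q, V q ∂(letterLaw σ lawE)
      = Real.log 2 * capE P σ lawE + 1 / 2 * powerSlope P σ lawE * (x ^ 2 - P) := by
    have i1 : Integrable (fun q : ℝ × ℝ => logGain P σ q.1) (letterLaw σ lawE) :=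
      (integrable_of_exp hlm (logGain_nonneg hP hσ) (by linarith)
        (integrable_exp_logGain hP hσ lawE hE le_rfl)).comp_fst _
    have i2 : Integrable (outPower P σ x) (letterLaw σ lawE) :=
      integrable_of_exp (γ := 1 / 4) hom (outPower_nonneg hP hσ x)
        (by norm_num) (integrable_exp_outPower hP hσ lawE (by norm_num) (by norm_num) x)
    have i3 : Integrable (fun q : ℝ × ℝ => q.2 ^ 2) (letterLaw σ lawE) :=
      (integrable_sq_gaussianReal σ).comp_snd lawE
    have e1 : ∫ q, logGain P σ q.1 ∂(letterLaw σ lawE) = meanLogGain P σ lawE := by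
      rw [integral_fun_fst]
      simp [meanLogGain, logGain]
    have e3 : ∫ q, q.2 ^ 2 ∂(letterLaw σ lawE) = σ ^ 2 := by
      rw [integral_fun_snd (f := fun u : ℝ => u ^ 2), integral_sq_gaussianReal]
      simp
    have i12 : Integrable (fun q => Real.log 2 / 2 * logGain P σ q.1
        + 1 / 2 * outPower P σ x q) (letterLaw σ lawE) :=
      (i1.const_mul _).add (i2.const_mul _)
    simp only [hV]
    rw [integral_sub i12 (i3.div_const _),
      integral_add (i1.const_mul _) (i2.const_mul _), integral_const_mul, integral_const_mul,
      integral_div, e1, e3, integral_outPower hP hσ lawE, capE]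
    field_simp
    ring
  calc ∫⁻ q, ENNReal.ofReal (Real.exp (s * letterLoss P σ ρ x q)) ∂(letterLaw σ lawE)
      ≤ ∫⁻ q, ENNReal.ofReal (Real.exp (s * V q)) ∂(letterLaw σ lawE) := by
        refine lintegral_mono fun q => ENNReal.ofReal_le_ofReal (Real.exp_le_exp.2 ?_)
        exact mul_le_mul_of_nonneg_left (letterLoss_le_gaussian hP hσ hρ x q) hs0.le
    _ ≤ _ := hmain
    _ ≤ _ := by
        refine ENNReal.ofReal_le_ofReal (Real.exp_le_exp.2 ?_)
        rw [hEV]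
        nlinarith

omit hP in
/-- Exponential moments of the loss grow at most like a power of the symbol. -/
theorem exists_lintegral_exp_letterLoss_le_log (hE : Integrable (fun h : ℝ => h ^ 2) lawE)
    {ρ : ℝ} (hρ : 0 < ρ) :
    ∃ k : ℝ, ∀ s x : ℝ, 0 < s → s ≤ 1 →
      ∫⁻ q, ENNReal.ofReal (Real.exp (s * letterLoss P σ ρ x q)) ∂(letterLaw σ lawE)
        ≤ ENNReal.ofReal (Real.exp (s * (k + Real.log (1 + x ^ 2)))) := by
  set Y : ℝ × ℝ → ℝ := fun q => (1 + 2 * q.1 ^ 2) * (1 + 2 * q.2 ^ 2) with hY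
  have hYi : Integrable Y (letterLaw σ lawE) :=
    Integrable.mul_prod (f := fun h : ℝ => 1 + 2 * h ^ 2) (g := fun u : ℝ => 1 + 2 * u ^ 2)
      ((integrable_const _).add (hE.const_mul 2))
      ((integrable_const _).add ((integrable_sq_gaussianReal σ).const_mul 2))
  have hY1 : ∀ q, 1 ≤ Y q := fun q => by
    have : 0 ≤ 2 * q.1 ^ 2 + 2 * q.2 ^ 2 + 2 * q.1 ^ 2 * (2 * q.2 ^ 2) := by positivity
    simp only [hY]
    linarith
  set m := ∫ q, Y q ∂(letterLaw σ lawE) with hm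
  have hm1 : 1 ≤ m := by
    have := integral_mono (integrable_const (1 : ℝ)) hYi hY1
    simpa using this
  have hm0 : 0 < m := by linarith
  refine ⟨-(1 / 2) * Real.log (2 * Real.pi * σ ^ 2) - Real.log ρ + Real.log m,
    fun s x hs hs1 => ?_⟩
  set k := -(1 / 2) * Real.log (2 * Real.pi * σ ^ 2) - Real.log ρ with hk
  have hpt : ∀ q, Real.exp (s * letterLoss P σ ρ x q)
      ≤ Real.exp (s * (k + Real.log m + Real.log (1 + x ^ 2))) * (1 - s + s / m * Y q) :=
    fun q => by
      have hYq : 0 < Y q := lt_of_lt_of_le one_pos (hY1 q)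
      have h1 := mul_le_mul_of_nonneg_left (letterLoss_le_tail (P := P) hσ hρ x q) hs.le
      -- Bernoulli's inequality for `(Y/m)^s` with `s ≤ 1`; the right-hand side has mean `1`, which
      -- makes this Jensen for a concave power.
      have h2 : Real.exp (s * (Real.log (Y q) - Real.log m)) ≤ 1 - s + s / m * Y q := by
        rw [← Real.log_div hYq.ne' hm0.ne', mul_comm, ← Real.rpow_def_of_pos (by positivity)]
        have h3 := rpow_one_add_le_one_add_mul_self (s := Y q / m - 1)
          (by have : 0 ≤ Y q / m := by positivity
              linarith) hs.le hs1
        rw [add_sub_cancel] at h3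
        refine h3.trans (le_of_eq ?_)
        ring
      calc Real.exp (s * letterLoss P σ ρ x q)
          ≤ Real.exp (s * (k + Real.log m + Real.log (1 + x ^ 2))
              + s * (Real.log (Y q) - Real.log m)) := by
            refine Real.exp_le_exp.2 (h1.trans (le_of_eq ?_))
            simp only [hY]
            ring
        _ ≤ _ := by
            rw [Real.exp_add]
            gcongr
  have hi : Integrable (fun q => 1 - s + s / m * Y q) (letterLaw σ lawE) :=
    (integrable_const _).add (hYi.const_mul _)
  refine (lintegral_mono fun q => ENNReal.ofReal_le_ofReal (hpt q)).trans ?_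
  rw [← ofReal_integral_eq_lintegral_ofReal (hi.const_mul _)
    (Eventually.of_forall fun q => (Real.exp_pos _).le.trans (hpt q)), integral_const_mul,
    integral_add (integrable_const _) (hYi.const_mul _), integral_const_mul, ← hm,
    div_mul_cancel₀ _ hm0.ne']
  simp

/-- Bounded symbols use the Gaussian bound. For large ones the logarithmic bound lies below a line
in `x²` of small slope `b`, chosen so that `bP` costs only `η/2`. -/
theorem exists_lintegral_exp_letterLoss_le (hE : Integrable (fun h : ℝ => h ^ 2) lawE)
    {η ρ : ℝ} (hη : 0 < η) (hρ : 0 < ρ) :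
    ∃ s c : ℝ, 0 < s ∧ 0 ≤ c ∧ ∀ x : ℝ,
      ∫⁻ q, ENNReal.ofReal (Real.exp (s * letterLoss P σ ρ x q)) ∂(letterLaw σ lawE)
        ≤ ENNReal.ofReal (Real.exp (s * (Real.log 2 * capE P σ lawE + η + c * (x ^ 2 - P)))) := by
  obtain ⟨k, hk⟩ := exists_lintegral_exp_letterLoss_le_log hσ lawE hE hρ
  have hl2 := half_lt_log_two
  set b := η / (2 * P) with hb
  have hb0 : 0 < b := by positivity
  have hbP : b * P = η / 2 := by
    rw [hb]
    field_simp
  -- Beyond `A`, the tangent bound `log y ≤ y - 1` at `y = (1+x²)b/2` gives `k + log(1+x²) ≤ b x²`;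
  -- `A ≥ P` keeps the term `κ(x²-P)` non-negative.
  set A := max P ((k + b / 2 - 1 - Real.log (b / 2)) / (b / 2)) with hA
  obtain ⟨s, hs0, hs1, hs⟩ :=
    exists_lintegral_exp_letterLoss_le_of_sq_le hP hσ lawE hE (half_pos hη) A
  have hκ := powerSlope_nonneg hP hσ lawE
  refine ⟨s, 1 / 2 * powerSlope P σ lawE + b, hs0, by positivity, fun x => ?_⟩
  rcases le_or_gt (x ^ 2) A with hx | hx
  · refine (hs ρ x hρ hx).trans (ENNReal.ofReal_le_ofReal (Real.exp_le_exp.2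
      (mul_le_mul_of_nonneg_left ?_ hs0.le)))
    nlinarith [mul_nonneg hb0.le (sq_nonneg x)]
  · refine (hk s x hs0 hs1).trans (ENNReal.ofReal_le_ofReal (Real.exp_le_exp.2
      (mul_le_mul_of_nonneg_left ?_ hs0.le)))
    have hxP : P < x ^ 2 := (le_max_left _ _).trans_lt hx
    have hxk : (k + b / 2 - 1 - Real.log (b / 2)) / (b / 2) < x ^ 2 :=
      (le_max_right _ _).trans_lt hx
    rw [div_lt_iff₀ (by positivity)] at hxk
    have h1 := Real.log_le_sub_one_of_pos (show 0 < (1 + x ^ 2) * (b / 2) by positivity)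
    rw [Real.log_mul (by positivity) (by positivity)] at h1
    have h2 := mul_nonneg hκ (sub_nonneg.2 hxP.le)
    have h3 := mul_nonneg (by linarith : 0 ≤ Real.log 2) (capE_nonneg hP hσ lawE)
    nlinarith

end SingleLetter

/-! ### The loss set: max-information, typicality and limits. -/

theorem smoothMaxInfo_le_maxInfoOn {M Z : Type*} [Fintype M] [MeasurableSpace Z]
    {W : M → Measure Z} {ε : ℝ} {T : Set (M × Z)} (h : IsTypical W ε T) :
    smoothMaxInfo W ε ≤ maxInfoOn W T :=
  iInf_le (fun T : {T : Set (M × Z) // IsTypical W ε T} => maxInfoOn W T.1) ⟨T, h⟩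

/-- The pairs of codeword and observation for which the total loss is less than `t`. -/
def lossSet (P σ ρ t : ℝ) {n : ℕ} (C : Finset (Fin n → ℝ)) : Set (C × Obs n) :=
  {p | ∑ i, letterLoss P σ ρ (p.1.1 i) (p.2.2.2 i, p.2.1 i - p.2.2.2 i * p.1.1 i) < t}

theorem measurableSet_lossSet_fiber (P σ ρ t : ℝ) {n : ℕ} (C : Finset (Fin n → ℝ)) (x : C) :
    MeasurableSet {z | (x, z) ∈ lossSet P σ ρ t C} := by
  have h := (measurableSet_le_sum x.1
    (fun i => measurable_letterLoss P σ ρ (x.1 i)) t).compl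
  convert h using 1
  ext z
  simp [lossSet]

section Main

variable {P σ : ℝ} (hP : 0 < P) (hσ : 0 < σ) (lawT lawE : Measure ℝ) [IsProbabilityMeasure lawT]
  [IsProbabilityMeasure lawE] {n : ℕ}

include hP hσ

theorem maxInfoOn_lossSet_le {C : Finset (Fin n → ℝ)} (hC : C.Nonempty) {ρ ζ b : ℝ} (hρ : 0 < ρ)
    (hζ : ρ * Real.pi ≤ ζ) :
    maxInfoOn (eveChannel σ lawT lawE C) (lossSet P σ ρ (n * b) C)
      ≤ ((n * (b + ζ) / Real.log 2 : ℝ) : EReal) := by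
  have : Nonempty C := hC.to_subtype
  set g : ℝ × ℝ → ℝ := fun q =>
    gaussianPDFReal 0 (Real.toNNReal (σ ^ 2 + q.1 ^ 2 * P)) q.2 + ρ * (1 + q.2 ^ 2)⁻¹ with hg
  have hgm : Measurable g := by
    have := measurable_gaussianPDFReal_output P σ 1
    simp only [one_mul] at this
    fun_prop
  have hgpos : ∀ q, 0 < g q := fun q =>
    add_pos (gaussianPDFReal_toNNReal_pos _ _ (variance_pos hP hσ _)) (by positivity)
  have hpm : Measurable fun p : Obs n => ∏ i, ENNReal.ofReal (g (p.2.2 i, p.1 i)) :=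
    Finset.measurable_prod _ fun i _ => (hgm.comp (by fun_prop)).ennreal_ofReal
  -- The perturbed density has mass `1 + ρπ ≤ e^ζ`, a cost of `ζ` per letter.
  have hgint : ∀ h, ∫⁻ z, ENNReal.ofReal (g (h, z)) ≤ ENNReal.ofReal (Real.exp ζ) := fun h => by
    have hi := integrable_inv_one_add_sq.const_mul ρ
    have hi' := integrable_gaussianPDFReal 0 (Real.toNNReal (σ ^ 2 + h ^ 2 * P))
    have hgi : Integrable fun z => gaussianPDFReal 0 (Real.toNNReal (σ ^ 2 + h ^ 2 * P)) z
        + ρ * (1 + z ^ 2)⁻¹ := hi'.add hi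
    simp only [hg]
    rw [← ofReal_integral_eq_lintegral_ofReal hgi
      (Eventually.of_forall fun z => (hgpos (h, z)).le),
      integral_add hi' hi, integral_const_mul,
      integral_univ_inv_one_add_sq, integral_gaussianPDFReal_eq_one _
        (by simpa using variance_pos hP hσ h)]
    exact ENNReal.ofReal_le_ofReal (by linarith [Real.add_one_le_exp ζ])
  refine maxInfoOn_le_of_density_le (ν := obsRef lawT lawE n)
    (f := fun x : C => obsDensity σ x.1)
    (g := fun p => ENNReal.ofReal (Real.exp (n * b)) * ∏ i, ENNReal.ofReal (g (p.2.2 i, p.1 i)))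
    (fun x => measurable_obsDensity σ x.1)
    (fun x => obsLaw_eq_withDensity hσ lawT lawE x.1)
    (measurableSet_lossSet_fiber P σ ρ (n * b) C) ?_ ?_ ?_
  · exact hpm.const_mul _
  · intro x p hp
    have hw : ∀ i, gaussianPDFReal (p.2.2 i * x.1 i) (Real.toNNReal (σ ^ 2)) (p.1 i)
        = Real.exp (letterLoss P σ ρ (x.1 i) (p.2.2 i, p.1 i - p.2.2 i * x.1 i))
          * g (p.2.2 i, p.1 i) := fun i => by
      have h1 := gaussianPDFReal_toNNReal_pos 0 (p.1 i - p.2.2 i * x.1 i)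
        (by positivity : 0 < σ ^ 2)
      have h2 : letterLoss P σ ρ (x.1 i) (p.2.2 i, p.1 i - p.2.2 i * x.1 i)
          = Real.log (gaussianPDFReal 0 (Real.toNNReal (σ ^ 2)) (p.1 i - p.2.2 i * x.1 i))
            - Real.log (g (p.2.2 i, p.1 i)) := by
        simp only [letterLoss, hg, add_sub_cancel]
      rw [h2, Real.exp_sub, Real.exp_log h1, Real.exp_log (hgpos _),
        div_mul_cancel₀ _ (hgpos _).ne', gaussianPDFReal_sub, zero_add]
    simp only [obsDensity, gaussianPDF, hw]
    rw [← ENNReal.ofReal_prod_of_nonneg fun i _ => (mul_pos (Real.exp_pos _) (hgpos _)).le,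
      ← ENNReal.ofReal_prod_of_nonneg fun i _ => (hgpos _).le,
      ← ENNReal.ofReal_mul (Real.exp_pos _).le, Finset.prod_mul_distrib, ← Real.exp_sum]
    exact ENNReal.ofReal_le_ofReal (mul_le_mul_of_nonneg_right
      (Real.exp_le_exp.2 (le_of_lt hp)) (Finset.prod_nonneg fun i _ => (hgpos _).le))
  · rw [lintegral_const_mul _ hpm]
    refine (mul_le_mul_right
      (lintegral_obsRef_prod_le lawT lawE hgm.ennreal_ofReal hgint) _).trans (le_of_eq ?_)
    rw [← ENNReal.ofReal_pow (Real.exp_pos _).le, ← ENNReal.ofReal_mul (Real.exp_pos _).le,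
      ← Real.exp_nat_mul, ← Real.exp_add, mul_add]

omit hP hσ in
theorem isTypical_lossSet {ρ a b c s ζ : ℝ} (hs : 0 < s) (hc : 0 ≤ c)
    (hsc : ∀ x : ℝ, ∫⁻ q, ENNReal.ofReal (Real.exp (s * letterLoss P σ ρ x q)) ∂(letterLaw σ lawE)
      ≤ ENNReal.ofReal (Real.exp (s * (a + c * (x ^ 2 - P))))) (hab : a + ζ ≤ b)
    (hn : 1 ≤ n) {C : Finset (Fin n → ℝ)} (hPC : PowerConstrained P C) :
    IsTypical (eveChannel σ lawT lawE C) (Real.exp (-(s * ζ * n)))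
      (lossSet P σ ρ (n * b) C) := by
  refine ⟨measurableSet_lossSet_fiber P σ _ _ C, fun x => ?_⟩
  have h1 := obsLaw_le_sum_le σ lawT lawE x.1
    (F := fun i q => s * letterLoss P σ ρ (x.1 i) q)
    (fun i => (measurable_letterLoss P σ _ _).const_mul s) (fun i => hsc (x.1 i)) (s * (n * b))
  have hset : {p : Obs n | s * (n * b) ≤ ∑ i, s * letterLoss P σ ρ (x.1 i)
        (p.2.2 i, p.1 i - p.2.2 i * x.1 i)}
      = {z | (x, z) ∈ lossSet P σ ρ (n * b) C}ᶜ := by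
    ext z
    simp [lossSet, ← Finset.mul_sum, mul_le_mul_iff_right₀ hs]
  -- The power constraint makes the `c`-terms sum to something non-positive; the gap `ζ` between `a`
  -- and `b` is the exponent.
  have hexp : ∑ i, s * (a + c * (x.1 i ^ 2 - P)) - s * (n * b) ≤ -(s * ζ * n) := by
    have h2 := mul_nonneg hs.le (mul_nonneg hc (neg_nonneg.2 (sum_sq_sub_le_zero hPC hn x.2)))
    have h3 := mul_le_mul_of_nonneg_left hab (mul_nonneg hs.le (Nat.cast_nonneg (α := ℝ) n))
    rw [← Finset.mul_sum, Finset.sum_add_distrib, ← Finset.mul_sum, Finset.sum_const,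
      Finset.card_univ, Fintype.card_fin, nsmul_eq_mul]
    linarith
  rw [hset, probReal_compl_eq_one_sub (measurableSet_lossSet_fiber P σ _ _ C x)] at h1
  have h3 := h1.trans (Real.exp_le_exp.2 hexp)
  simp only [eveChannel]
  linarith

theorem exists_smoothMaxInfo_le (hE : Integrable (fun h : ℝ => h ^ 2) lawE) {η : ℝ} (hη : 0 < η) :
    ∃ c : ℝ, 0 < c ∧ ∀ (n : ℕ) (C : Finset (Fin n → ℝ)), 1 ≤ n → C.Nonempty →
      PowerConstrained P C →
      smoothMaxInfo (eveChannel σ lawT lawE C) (Real.exp (-(c * n)))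
        ≤ ((n * (capE P σ lawE + η) : ℝ) : EReal) := by
  have hl2 : 0 < Real.log 2 := Real.log_pos one_lt_two
  have hpi := Real.pi_pos
  -- Three equal losses: moment bound, Chernoff gap, and mass of the auxiliary density.
  set ζ := η * Real.log 2 / 3 with hζ
  have hζ0 : 0 < ζ := by positivity
  have hρ0 : 0 < ζ / Real.pi := by positivity
  obtain ⟨s, c, hs, hc, hsc⟩ := exists_lintegral_exp_letterLoss_le hP hσ lawE hE hζ0 hρ0
  refine ⟨s * ζ, by positivity, fun n C hn hC hPC => ?_⟩
  set b := Real.log 2 * capE P σ lawE + 2 * ζ with hb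
  have htyp := isTypical_lossSet lawT lawE hs hc hsc (b := b) (ζ := ζ)
    (le_of_eq (by rw [hb]; ring)) hn hPC
  have hle := (smoothMaxInfo_le_maxInfoOn htyp).trans
    (maxInfoOn_lossSet_le hP hσ lawT lawE hC hρ0 (le_of_eq (div_mul_cancel₀ ζ hpi.ne')))
  refine hle.trans (EReal.coe_le_coe_iff.2 (le_of_eq ?_))
  rw [hb, hζ]
  field_simp
  ring

omit hP hσ in
theorem coe_natCast_mul_div (hn : 1 ≤ n) (a : ℝ) : ((n * a : ℝ) : EReal) / (n : EReal) = a := by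
  have hn0 : (n : ℝ) ≠ 0 := by positivity
  rw [show ((n : ℕ) : EReal) = ((n : ℝ) : EReal) from rfl, ← EReal.coe_div,
    mul_div_cancel_left₀ _ hn0]

omit hP hσ in
theorem limsup_div_natCast_le {u : ℕ → EReal} {a : ℝ}
    (h : ∀ᶠ n : ℕ in atTop, u n ≤ ((n * a : ℝ) : EReal)) :
    limsup (fun n : ℕ => u n / (n : EReal)) atTop ≤ (a : EReal) := by
  refine limsup_le_of_le (by isBoundedDefault) ?_
  filter_upwards [h, eventually_ge_atTop 1] with n hn h1
  rw [← coe_natCast_mul_div h1 a]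
  exact EReal.div_le_div_right_of_nonneg (by positivity) hn

omit hP hσ in
theorem le_coe_of_forall_pos_le_coe_add {a : EReal} {b : ℝ}
    (h : ∀ η : ℝ, 0 < η → a ≤ ((b + η : ℝ) : EReal)) : a ≤ (b : EReal) := by
  refine EReal.le_of_forall_lt_iff_le.1 fun z hz => ?_
  have hz' : b < z := by exact_mod_cast hz
  simpa using h (z - b) (sub_pos.2 hz')

theorem limsup_maxInfoOn_typicalSet_le {C : (n : ℕ) → Finset (Fin n → ℝ)}
    (hC : ∀ n, (C n).Nonempty) {δ δ' δ'' : ℕ → ℝ} (hδ : ∀ n, 0 < δ n)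
    (hδ0 : Tendsto δ atTop (𝓝 0)) (hδ'0 : Tendsto δ' atTop (𝓝 0))
    (hδ''0 : Tendsto δ'' atTop (𝓝 0)) :
    limsup (fun n : ℕ => maxInfoOn (eveChannel σ lawT lawE (C n))
        (typicalSet P σ lawE (δ n) (δ' n) (δ'' n) (C n)) / (n : EReal)) atTop
      ≤ (capE P σ lawE : EReal) := by
  have hl2 : 0 < Real.log 2 := Real.log_pos one_lt_two
  set f : ℕ → ℝ := fun n => (1 / 2 * Real.log (1 + δ n) + δ' n / 2
    + Real.log 2 / 2 * (meanLogGain P σ lawE + δ'' n)) / Real.log 2 with hf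
  have hlim : Tendsto f atTop (𝓝 (capE P σ lawE)) := by
    have h1 : Tendsto (fun n => Real.log (1 + δ n)) atTop (𝓝 0) := by
      have := (hδ0.const_add 1).log (by norm_num)
      simpa using this
    have h2 := (((h1.const_mul (1 / 2)).add (hδ'0.div_const 2)).add
      ((hδ''0.const_add (meanLogGain P σ lawE)).const_mul (Real.log 2 / 2))).div_const (Real.log 2)
    convert h2 using 2
    rw [capE]
    field_simp
    ring
  refine le_coe_of_forall_pos_le_coe_add fun η hη => limsup_div_natCast_le ?_
  filter_upwards [hlim.eventually_le_const (lt_add_of_pos_right _ hη), eventually_ge_atTop 1]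
    with n h1 hn
  refine (maxInfoOn_typicalSet_le hP hσ lawT lawE hn (hC n) (hδ n)).trans ?_
  rw [EReal.coe_le_coe_iff, mul_div_assoc]
  gcongr

omit hP hσ in
-- As `δ n → 0`, the first summand of `eps` alone decays subexponentially.
theorem eventually_exp_neg_le_eps {c : ℝ} (K : ℝ) (hc : 0 < c) {δ : ℕ → ℝ}
    (hδ : Tendsto δ atTop (𝓝 0)) (δ' δ'' : ℕ → ℝ) :
    ∀ᶠ n : ℕ in atTop, Real.exp (-(c * n)) ≤ eps K n (δ n) (δ' n) (δ'' n) := by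
  have h1 : Tendsto (fun n => 1 / (4 * K) * δ n ^ 2) atTop (𝓝 0) := by
    simpa using (hδ.pow 2).const_mul (1 / (4 * K))
  filter_upwards [h1.eventually_le_const hc] with n hn
  have h2 : Real.exp (-(c * n)) ≤ Real.exp (-((n : ℝ) * (1 / (4 * K)) * δ n ^ 2)) := by
    refine Real.exp_le_exp.2 (neg_le_neg ?_)
    rw [mul_assoc, mul_comm c]
    gcongr
  rw [eps]
  have h3 := Real.exp_pos (-((n : ℝ) * (1 / (4 * K)) * δ n ^ 2))
  have h4 := Real.exp_pos (-((n : ℝ) / 4 * δ' n ^ 2))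
  have h5 := Real.exp_pos (-((n : ℝ) * (1 / (4 * K)) * δ'' n ^ 2))
  linarith

/-- Smoothing more only lowers the infimum, so the bound at `e^{-cn}` transfers to `eps` for every
`η`, whatever `K` is. -/
theorem limsup_smoothMaxInfo_eps_le (hE : Integrable (fun h : ℝ => h ^ 2) lawE)
    {C : (n : ℕ) → Finset (Fin n → ℝ)} (hC : ∀ n, (C n).Nonempty)
    (hPC : ∀ n, PowerConstrained P (C n)) {δ : ℕ → ℝ} (hδ : Tendsto δ atTop (𝓝 0))
    (δ' δ'' : ℕ → ℝ) (K : ℝ) :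
    limsup (fun n : ℕ => smoothMaxInfo (eveChannel σ lawT lawE (C n))
        (eps K n (δ n) (δ' n) (δ'' n)) / (n : EReal)) atTop
      ≤ (capE P σ lawE : EReal) := by
  refine le_coe_of_forall_pos_le_coe_add fun η hη => limsup_div_natCast_le ?_
  obtain ⟨c, hc, h⟩ := exists_smoothMaxInfo_le hP hσ lawT lawE hE hη
  filter_upwards [eventually_exp_neg_le_eps K hc hδ δ' δ'', eventually_ge_atTop 1] with n h1 hn
  exact (smoothMaxInfo_anti _ h1).trans (h n (C n) hn (hC n) (hPC n))

end Main

theorem mainTheorem5 (P σ : ℝ) (hP : 0 < P) (hσ : 0 < σ)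
    (lawT lawE : Measure ℝ) [IsProbabilityMeasure lawT] [IsProbabilityMeasure lawE]
    (hT_nonneg : ∀ᵐ h ∂lawT, 0 ≤ h) (hE_nonneg : ∀ᵐ h ∂lawE, 0 ≤ h)
    (hE_sq : Integrable (fun h : ℝ => h ^ 2) lawE) :
    -- the sets are typical
    (∀ γ : ℝ, 0 < γ → γ < 1 / 2 → ∃ δ₀ : ℝ, 0 < δ₀ ∧
      ∀ (n : ℕ) (C : Finset (Fin n → ℝ)) (K δ δ' δ'' : ℝ), 1 ≤ n → PowerConstrained P C →
        IsTailBound P σ lawE γ C K →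
        0 < δ → δ ≤ δ₀ → 0 < δ' → 0 < δ'' → δ'' ≤ δ₀ →
        IsTypical (eveChannel σ lawT lawE C) (eps K n δ δ' δ'')
          (typicalSet P σ lawE δ δ' δ'' C)) ∧
    -- max-information on these sets, and smooth max-information, for vanishing parameters
    (∀ C : (n : ℕ) → Finset (Fin n → ℝ), (∀ n, (C n).Nonempty) →
      (∀ n, PowerConstrained P (C n)) →
      ∀ δ δ' δ'' : ℕ → ℝ, (∀ n, 0 < δ n) → (∀ n, 0 < δ' n) → (∀ n, 0 < δ'' n) →
        Tendsto δ atTop (𝓝 0) → Tendsto δ' atTop (𝓝 0) → Tendsto δ'' atTop (𝓝 0) →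
        limsup (fun n : ℕ => maxInfoOn (eveChannel σ lawT lawE (C n))
            (typicalSet P σ lawE (δ n) (δ' n) (δ'' n) (C n)) / (n : EReal)) atTop
          ≤ (capE P σ lawE : EReal) ∧
        ∀ K : ℝ, 0 < K →
          limsup (fun n : ℕ => smoothMaxInfo (eveChannel σ lawT lawE (C n))
              (eps K n (δ n) (δ' n) (δ'' n)) / (n : EReal)) atTop
            ≤ (capE P σ lawE : EReal)) ∧
    -- smooth max-information with a fixed exponential decay of the smoothing parameter
    (∀ η : ℝ, 0 < η → ∃ c : ℝ, 0 < c ∧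
      ∀ C : (n : ℕ) → Finset (Fin n → ℝ), (∀ n, (C n).Nonempty) →
        (∀ n, PowerConstrained P (C n)) →
        limsup (fun n : ℕ => smoothMaxInfo (eveChannel σ lawT lawE (C n))
            (Real.exp (-(c * n))) / (n : EReal)) atTop
          ≤ ((capE P σ lawE + η : ℝ) : EReal)) := by
  refine ⟨fun γ hγ hγ' => ?_, fun C hC hPC δ δ' δ'' hδ hδ' hδ'' h h' h'' =>
    ⟨limsup_maxInfoOn_typicalSet_le hP hσ lawT lawE hC hδ h h' h'', fun K _ =>
      limsup_smoothMaxInfo_eps_le hP hσ lawT lawE hE_sq hC hPC h δ' δ'' K⟩, fun η hη => ?_⟩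
  · refine ⟨γ * (1 - powerSlope P σ lawE * P) ^ 2,
      mul_pos hγ (pow_pos (sub_pos.2 (powerSlope_mul_lt_one hP hσ lawE)) 2), ?_⟩
    intro n C K δ δ' δ'' hn hC hK hδ hδ0 hδ' hδ'' hδ''0
    exact isTypical_typicalSet hP hσ lawT lawE hT_nonneg hE_nonneg hE_sq hγ hγ' hn hC hK hδ hδ0
      hδ' hδ'' hδ''0
  · obtain ⟨c, hc, h⟩ := exists_smoothMaxInfo_le hP hσ lawT lawE hE_sq hη
    refine ⟨c, hc, fun C hC hPC => limsup_div_natCast_le ?_⟩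
    filter_upwards [eventually_ge_atTop 1] with n hn
    exact h n (C n) hn (hC n) (hPC n)
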